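/- Let $Z$ be a locally compact metric space with a $p$-dimensional lamination $\mathcal L$, i.e. an atlas of charts $\mathbb R^p\times T_i\to Z$, each a homeomorphism onto an open subset, which cover $Z$ and whose coordinate changes are locally of the form $(u,s)\mapsto(\alpha(u,s),\beta(s))$. Assume that $\mathcal L$ is minimal, i.e. every leaf is dense in $Z$. Let $h:\mathbb R^p\times X\to Z$ be a lamination chart (a homeomorphism onto an open subset of $Z$, compatible with the atlas) with $X\neq\emptyset$; identify the cross section $X$ with $h(\{0\}\times X)$ and give it the metric $d$ induced from $Z$. A holonomy map is a homeomorphism $\gamma$ from an open subset $\mathrm{Dom}(\gamma)$ of $X$ onto an open subset of $X$ such that near each $x\in\mathrm{Dom}(\gamma)$ it is the holonomy along some leafwise curve $c$ from $x$ to $\gamma x$: $c$ extends to a continuous family of leafwise curves from $x'$ to $\gamma x'$, for $x'$ in a neighbourhood of $x$. A pseudo*group is a set of local homeomorphisms of $X$ that contains the identity, is closed under inversion and under restriction to open subsets of domains, and contains $\gamma'\circ\gamma$ whenever it contains $\gamma,\gamma'$ and the domain of $\gamma'$ is the range of $\gamma$. Assume that $\mathcal L$ is transversely equicontinuous with respect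 to $X$: there is a pseudo*group $\Gamma$ of holonomy maps, containing for each holonomy map $\gamma$ and each $x\in\mathrm{Dom}(\gamma)$ the restriction of $\gamma$ to some open neighbourhood of $x$, which is equicontinuous, i.e. for every $\epsilon>0$ there is $\delta>0$ such that $d(\gamma x,\gamma x')\le\epsilon$ for all $\gamma\in\Gamma$ and $x,x'\in\mathrm{Dom}(\gamma)$ with $d(x,x')<\delta$. Then there is a nonzero Radon measure $\mu$ on $X$ which is invariant under every holonomy map $\gamma$, i.e. $\mu(\zeta\circ\gamma^{-1})=\mu(\zeta)$ for every continuous $\zeta:X\to\mathbb R$ with compact support contained in $\mathrm{Dom}(\gamma)$ (where $\zeta\circ\gamma^{-1}$ is extended by $0$). If moreover $Z$ is compact, this measure is unique up to scaling: if $\mu\ne0$ and $\nu$ are Radon measures on $X$ invariant under every holonomy map, then $\nu=c\mu$ for some $c\ge0$. -/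

import Mathlib

open Set Filter Topology MeasureTheory unitInterval

/-- The model `ℝ^p` of the plaques. -/
abbrev PlaqueModel (p : ℕ) : Type := EuclideanSpace ℝ (Fin p)

/-- The plaque `φ (ℝ^p × {s})` of a map `φ : ℝ^p × S → Z`. -/
def plaque {p : ℕ} {Z S : Type*} (φ : PlaqueModel p × S → Z) (s : S) : Set Z :=
  range fun u => φ (u, s)

/-- Where the images of `φ` and `ψ` overlap, the coordinate change `ψ⁻¹ ∘ φ` is locally of the form
`(u, s) ↦ (α (u, s), β s)`: plaques of `φ` are locally contained in plaques of `ψ`. -/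
def PlaqueCompatible {p : ℕ} {Z S T : Type*} [TopologicalSpace S]
    (φ : PlaqueModel p × S → Z) (ψ : PlaqueModel p × T → Z) : Prop :=
  ∀ (u : PlaqueModel p) (s : S), φ (u, s) ∈ range ψ →
    ∃ W ∈ 𝓝 u, ∃ V ∈ 𝓝 s, ∃ β : S → T, ∀ u' ∈ W, ∀ s' ∈ V, φ (u', s') ∈ plaque ψ (β s')

/-- A `p`-dimensional lamination on `Z`, given by an atlas of charts `ℝ^p × T i → Z`, each a
homeomorphism onto an open subset of `Z`, with plaque-preserving coordinate changes. -/
structure Lamination.{u} (p : ℕ) (Z : Type u) [TopologicalSpace Z] where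
  /-- index set of the atlas -/
  ι : Type u
  /-- the transverse space of a chart -/
  T : ι → Type u
  /-- the topology of the transverse space -/
  topT : ∀ i, TopologicalSpace (T i)
  /-- the charts -/
  φ : ∀ i, PlaqueModel p × T i → Z
  isOpenEmbedding : ∀ i, IsOpenEmbedding (φ i)
  cover : ∀ z : Z, ∃ i, z ∈ range (φ i)
  compatible : ∀ i j, PlaqueCompatible (φ i) (φ j)

namespace Lamination

attribute [instance] Lamination.topT

section Leaves

variable {p : ℕ} {Z : Type*} [TopologicalSpace Z] (L : Lamination p Z)

/-- A leafwise curve: a continuous curve which locally stays in a single plaque. -/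
def IsLeafwise (c : I → Z) : Prop :=
  Continuous c ∧ ∀ t : I, ∃ (i : L.ι) (s : L.T i), ∀ᶠ t' in 𝓝 t, c t' ∈ plaque (L.φ i) s

/-- The leaf through `z`: all points joined to `z` by a leafwise curve. -/
def leaf (z : Z) : Set Z :=
  {w | ∃ c : I → Z, L.IsLeafwise c ∧ c 0 = z ∧ c 1 = w}

/-- A lamination is minimal if every leaf is dense. -/
def IsMinimal : Prop := ∀ z : Z, Dense (L.leaf z)

/-- A lamination chart `h : ℝ^p × X → Z`: a homeomorphism onto an open subset of `Z`, compatible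
with the atlas, so that it could be added to it. Its cross section is `h ({0} × X)`, identified
with `X`. -/
structure IsChart {X : Type*} [TopologicalSpace X] (h : PlaqueModel p × X → Z) : Prop where
  isOpenEmbedding : IsOpenEmbedding h
  compatible_left : ∀ i, PlaqueCompatible h (L.φ i)
  compatible_right : ∀ i, PlaqueCompatible (L.φ i) h

variable {X : Type*} [TopologicalSpace X] (h : PlaqueModel p × X → Z)

/-- Near `x`, the local homeomorphism `γ` of the cross section is the holonomy along the leafwise
curve `c` from `x` to `γ x`: the curve `c` extends to a continuous family of leafwise curves
`H (·, x')`, joining `x'` to `γ x'`, for all `x'` in a neighbourhood `D` of `x`. -/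
def IsHolonomyAlong (c : I → Z) (γ : OpenPartialHomeomorph X X) (x : X) : Prop :=
  ∃ D : Set X, IsOpen D ∧ x ∈ D ∧ D ⊆ γ.source ∧
    ∃ H : I × X → Z, ContinuousOn H (univ ×ˢ D) ∧ (∀ t, H (t, x) = c t) ∧
      ∀ x' ∈ D, L.IsLeafwise (fun t => H (t, x')) ∧
        H (0, x') = h (0, x') ∧ H (1, x') = h (0, γ x')

/-- `γ` is a holonomy map of the cross section: around each point of its domain it is the holonomy
along some leafwise curve. -/
def IsHolonomyMap (γ : OpenPartialHomeomorph X X) : Prop :=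
  ∀ x ∈ γ.source, ∃ c : I → Z, L.IsHolonomyAlong h c γ x

end Leaves

end Lamination

/-- A pseudo*group of local homeomorphisms of `X`: closed under restriction to open subsets of the
domain, composition of `γ` and `γ'` if `Dom γ' = Range γ`, and inversion, and containing the
identity. Unlike for a pseudogroup, unions of maps are not required to belong to it. -/
structure IsPseudoStarGroup {X : Type*} [TopologicalSpace X]
    (Γ : Set (OpenPartialHomeomorph X X)) : Prop where
  restr_mem : ∀ γ ∈ Γ, ∀ (U : Set X) (hU : IsOpen U), U ⊆ γ.source → γ.restrOpen U hU ∈ Γ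
  refl_mem : OpenPartialHomeomorph.refl X ∈ Γ
  trans_mem : ∀ γ ∈ Γ, ∀ γ' ∈ Γ, γ.target = γ'.source → γ.trans γ' ∈ Γ
  symm_mem : ∀ γ ∈ Γ, γ.symm ∈ Γ

namespace Lamination

section Transverse

variable {p : ℕ} {Z : Type*} [MetricSpace Z] (L : Lamination p Z)
  {X : Type*} [TopologicalSpace X] (h : PlaqueModel p × X → Z)

/-- `Γ` is a holonomy pseudo*group of the cross section: a pseudo*group of holonomy maps in which
every holonomy map occurs after shrinking its domain around any given point. The domains are
left to the choice of `Γ`, because on a disconnected domain a map which is locally the holonomy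
along some curve may follow unrelated curves on different pieces. -/
structure IsHolonomyPseudoStarGroup (Γ : Set (OpenPartialHomeomorph X X)) : Prop where
  isPseudoStarGroup : IsPseudoStarGroup Γ
  isHolonomyMap : ∀ γ ∈ Γ, L.IsHolonomyMap h γ
  exists_restr : ∀ γ : OpenPartialHomeomorph X X, L.IsHolonomyMap h γ → ∀ x ∈ γ.source,
    ∃ γ' ∈ Γ, x ∈ γ'.source ∧ γ'.source ⊆ γ.source ∧ EqOn γ' γ γ'.source

/-- The lamination is transversely equicontinuous with respect to the cross section: its holonomy
maps, on suitable domains, are equicontinuous for the metric induced from `Z`. -/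
def TransverselyEquicontinuous : Prop :=
  ∃ Γ : Set (OpenPartialHomeomorph X X), L.IsHolonomyPseudoStarGroup h Γ ∧
    ∀ ε > 0, ∃ δ > 0, ∀ γ ∈ Γ, ∀ x ∈ γ.source, ∀ x' ∈ γ.source,
      dist (h (0, x)) (h (0, x')) < δ → dist (h (0, γ x)) (h (0, γ x')) ≤ ε

/-- `μ` is left invariant by every holonomy map `γ`: `μ (ζ ∘ γ⁻¹) = μ ζ` for each continuous `ζ`
with compact support in the domain of `γ`, where `ζ ∘ γ⁻¹` is `0` outside the range of `γ`. -/
def HolonomyInvariant [MeasurableSpace X] (μ : Measure X) : Prop :=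
  ∀ γ : OpenPartialHomeomorph X X, L.IsHolonomyMap h γ →
    ∀ ζ : X → ℝ, Continuous ζ → HasCompactSupport ζ → tsupport ζ ⊆ γ.source →
      ∫ y in γ.target, ζ (γ.symm y) ∂μ = ∫ x, ζ x ∂μ

end Transverse

end Lamination

/-! Existence is Haar's construction with the pseudo*group `Γ` in place of a group. For a test
function `φ`, the covering number `(f : φ)` is the least total weight of a combination of translates
of `φ` dominating `f`. Minimality makes it meaningful: every orbit meets the region where `φ` is
large, so every compactly supported `f` can be covered. It is subadditive, homogeneous and
`Γ`-invariant, and `(f : φ) ≤ (f : f₀) (f₀ : φ)`. Hence the ratios `(f : φ) / (f₀ : φ)` stay in a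
compact interval and converge along an ultrafilter as `φ` shrinks to a point. Equicontinuity says
that all translates of a narrow `φ` are narrow, so a cover of `f₁ + f₂` can be split almost without
loss (`exists_coveringNumber_add_le`). The limit is therefore additive, and the Riesz representation
theorem gives the measure. A partition of unity extends invariance from `Γ` to all holonomy maps
(`integralInvariant_of_local`).

For uniqueness, let `E r` be the set of `Γ`-images of pairs at distance less than `r`. These sets
are open, symmetric and invariant, and by equicontinuity they shrink to the diagonal. If enough maps
of `Γ` are defined on balls of a fixed size, the fibres of `E r` over a relatively compact open set
`V` all have the same measure (`measure_fiber_eq`). Christensen's argument, i.e. Fubini on `V × V`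
and Fatou's lemma, then compares two invariant measures on `V` through the ratio of their fibre
measures (`measure_le_liminf_mul`). Exchanging the measures gives proportionality.

Compactness of `Z` provides the maps with uniform domains (`IsMinimal.exists_hasUniformDomains`).
Finitely many local projections to the cross section cover `Z`, with transition maps defined on
balls of a uniform radius. Following a leafwise curve, one composes these transitions;
equicontinuity keeps the image of a fixed small ball inside the next domain, however long the curve
is. -/

open scoped NNReal ENNReal CompactlySupported

/-! ### Pseudo*groups of local homeomorphisms -/

namespace IsPseudoStarGroup

variable {X : Type*} [TopologicalSpace X] {Γ : Set (OpenPartialHomeomorph X X)}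

/-- A pseudo*group is closed under composition, on the largest domain where it makes sense. -/
theorem trans_mem' (hΓ : IsPseudoStarGroup Γ) {γ γ' : OpenPartialHomeomorph X X} (hγ : γ ∈ Γ)
    (hγ' : γ' ∈ Γ) : γ.trans γ' ∈ Γ := by
  obtain ⟨U, hU, hUo, hUs⟩ : ∃ U, U = (γ.trans γ').source ∧ IsOpen U ∧ U ⊆ γ.source :=
    ⟨_, rfl, (γ.trans γ').open_source, by simp⟩
  rw [OpenPartialHomeomorph.trans_source] at hU
  have h1 := hΓ.restr_mem _ hγ U hUo hUs
  have h2 := hΓ.restr_mem _ hγ' (γ'.source ∩ γ.target) (γ'.open_source.inter γ.open_target)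
    inter_subset_left
  have h3 := hΓ.trans_mem _ h1 _ h2 ?_
  · convert h3 using 1
    refine OpenPartialHomeomorph.ext _ _ (fun x => rfl) (fun x => rfl) ?_
    ext x
    simp only [OpenPartialHomeomorph.trans_source, OpenPartialHomeomorph.restrOpen_source,
      mem_inter_iff, mem_preimage, hU]
    constructor
    · rintro ⟨a, b⟩
      exact ⟨⟨a, a, b⟩, b, b, γ.map_source a⟩
    · rintro ⟨⟨a, -, b⟩, -⟩
      exact ⟨a, b⟩
  · have e := (γ.restrOpen U hUo).image_source_eq_target
    rw [← e, OpenPartialHomeomorph.restrOpen_source, OpenPartialHomeomorph.restrOpen_source,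
      inter_eq_self_of_subset_right hUs]
    change γ '' U = _
    ext y
    simp only [mem_inter_iff]
    constructor
    · rintro ⟨x, hx, rfl⟩
      rw [hU] at hx
      exact ⟨hx.2, hx.2, γ.map_source hx.1⟩
    · rintro ⟨a, -, b⟩
      refine ⟨γ.symm y, ?_, γ.right_inv b⟩
      rw [hU]
      exact ⟨γ.map_target b, by rwa [mem_preimage, γ.right_inv b]⟩

end IsPseudoStarGroup

/-! ### Transport of functions by local homeomorphisms -/

/-- The function `f` transported by `γ`, and extended by `0` outside the range of `γ`. -/
noncomputable def OpenPartialHomeomorph.push {X M : Type*} [TopologicalSpace X] [Zero M]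
    (γ : OpenPartialHomeomorph X X) (f : X → M) : X → M :=
  γ.target.indicator (f ∘ γ.symm)

section Push

variable {X M : Type*} [TopologicalSpace X]

theorem push_of_mem [Zero M] (γ : OpenPartialHomeomorph X X) (f : X → M) {y : X} (hy : y ∈ γ.target) :
    γ.push f y = f (γ.symm y) := indicator_of_mem hy _

theorem push_of_notMem [Zero M] (γ : OpenPartialHomeomorph X X) (f : X → M) {y : X}
    (hy : y ∉ γ.target) : γ.push f y = 0 := indicator_of_notMem hy _

theorem push_apply_map [Zero M] (γ : OpenPartialHomeomorph X X) (f : X → M) {x : X}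
    (hx : x ∈ γ.source) : γ.push f (γ x) = f x := by
  rw [push_of_mem _ _ (γ.map_source hx), γ.left_inv hx]

theorem push_push [Zero M] (γ γ' : OpenPartialHomeomorph X X) (f : X → M) :
    γ'.push (γ.push f) = (γ.trans γ').push f := by
  classical
  ext y
  simp only [OpenPartialHomeomorph.push, indicator_apply, OpenPartialHomeomorph.trans_target,
    mem_inter_iff, mem_preimage, Function.comp_apply, OpenPartialHomeomorph.coe_trans_symm]
  by_cases h1 : y ∈ γ'.target <;> simp [h1]

theorem push_add [AddZeroClass M] (γ : OpenPartialHomeomorph X X) (f g : X → M) :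
    γ.push (f + g) = γ.push f + γ.push g :=
  indicator_add γ.target (f ∘ γ.symm) (g ∘ γ.symm)

theorem push_smul {R : Type*} [Zero M] [SMulZeroClass R M] (γ : OpenPartialHomeomorph X X) (c : R)
    (f : X → M) : γ.push (c • f) = c • γ.push f :=
  indicator_const_smul γ.target c (f ∘ γ.symm)

theorem push_zero [Zero M] (γ : OpenPartialHomeomorph X X) : γ.push (0 : X → M) = 0 :=
  Set.indicator_zero M γ.target

theorem push_mono (γ : OpenPartialHomeomorph X X) {f g : X → ℝ≥0} (h : f ≤ g) :
    γ.push f ≤ γ.push g := fun y => by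
  by_cases hy : y ∈ γ.target
  · simpa [push_of_mem _ _ hy] using h _
  · simp [push_of_notMem _ _ hy]

theorem push_symm_push [Zero M] (γ : OpenPartialHomeomorph X X) {f : X → M}
    (hf : Function.support f ⊆ γ.source) : γ.symm.push (γ.push f) = f := by
  ext x
  by_cases hx : x ∈ γ.source
  · rw [push_of_mem _ _ (by simpa using hx)]
    simpa using push_apply_map γ f hx
  · rw [push_of_notMem _ _ (by simpa using hx)]
    by_contra h
    exact hx (hf (Ne.symm h))

theorem support_push_subset [Zero M] (γ : OpenPartialHomeomorph X X) (f : X → M) :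
    Function.support (γ.push f) ⊆ γ '' (Function.support f ∩ γ.source) := by
  intro y hy
  have hy' : y ∈ γ.target := by
    by_contra h
    exact hy (push_of_notMem _ _ h)
  rw [Function.mem_support, push_of_mem _ _ hy'] at hy
  exact ⟨γ.symm y, ⟨hy, γ.map_target hy'⟩, γ.right_inv hy'⟩

variable [T2Space X]

theorem tsupport_push_subset [Zero M] (γ : OpenPartialHomeomorph X X) {f : X → M}
    (hc : HasCompactSupport f) (hf : tsupport f ⊆ γ.source) :
    tsupport (γ.push f) ⊆ γ '' tsupport f := by
  have hK : IsCompact (γ '' tsupport f) := hc.isCompact.image_of_continuousOn (γ.continuousOn.mono hf)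
  exact closure_minimal ((support_push_subset γ f).trans
    (image_mono (inter_subset_left.trans (subset_tsupport f)))) hK.isClosed

theorem hasCompactSupport_push [Zero M] (γ : OpenPartialHomeomorph X X) {f : X → M}
    (hc : HasCompactSupport f) (hf : tsupport f ⊆ γ.source) : HasCompactSupport (γ.push f) :=
  (hc.isCompact.image_of_continuousOn (γ.continuousOn.mono hf)).of_isClosed_subset
    (isClosed_tsupport _) (tsupport_push_subset γ hc hf)

/-- The extension by zero creates no jump, because the support of the transported function is
compact, hence closed, and lies inside the open range of `γ`. -/
theorem continuous_push [Zero M] [TopologicalSpace M] (γ : OpenPartialHomeomorph X X) {f : X → M}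
    (hcont : Continuous f) (hc : HasCompactSupport f) (hf : tsupport f ⊆ γ.source) :
    Continuous (γ.push f) := by
  have hsub : tsupport (γ.push f) ⊆ γ.target :=
    (tsupport_push_subset γ hc hf).trans (by
      rintro _ ⟨x, hx, rfl⟩
      exact γ.map_source (hf hx))
  have hon : ContinuousOn (γ.push f) γ.target :=
    (hcont.comp_continuousOn γ.continuousOn_symm).congr fun y hy => push_of_mem _ _ hy
  refine continuous_of_tsupport fun y hy => hon.continuousAt (γ.open_target.mem_nhds (hsub hy))

end Push

/-! ### Covering numbers with respect to a pseudo*group -/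

section Covering

variable {X : Type*} [TopologicalSpace X] (Γ : Set (OpenPartialHomeomorph X X))

/-- The cone spanned by the translates of `φ`, together with the total weights. -/
noncomputable def coveringCone (φ : X → ℝ≥0) : Submodule ℝ≥0 ((X → ℝ≥0) × ℝ≥0) :=
  Submodule.span ℝ≥0 {q | ∃ γ ∈ Γ, q = (γ.push φ, 1)}

/-- `f` is dominated by a finite combination of translates of `φ`. -/
def IsCoverable (f φ : X → ℝ≥0) : Prop := ∃ q ∈ coveringCone Γ φ, f ≤ q.1

/-- Haar's covering number: the least total weight of a combination of translates of `φ` which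
dominates `f`. -/
noncomputable def coveringNumber (f φ : X → ℝ≥0) : ℝ≥0 :=
  sInf {m | ∃ g, (g, m) ∈ coveringCone Γ φ ∧ f ≤ g}

variable {Γ} {f g φ ψ : X → ℝ≥0}

theorem coveringNumber_le {m : ℝ≥0} (hg : (g, m) ∈ coveringCone Γ φ) (h : f ≤ g) :
    coveringNumber Γ f φ ≤ m := csInf_le (OrderBot.bddBelow _) ⟨g, hg, h⟩

theorem IsCoverable.exists_lt (hf : IsCoverable Γ f φ) {m : ℝ≥0} (h : coveringNumber Γ f φ < m) :
    ∃ g m', (g, m') ∈ coveringCone Γ φ ∧ f ≤ g ∧ m' < m := by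
  obtain ⟨q, hq, hfq⟩ := hf
  obtain ⟨m', ⟨g, h1, h2⟩, h3⟩ := exists_lt_of_csInf_lt
    (s := {m | ∃ g, (g, m) ∈ coveringCone Γ φ ∧ f ≤ g}) ⟨q.2, q.1, hq, hfq⟩ h
  exact ⟨g, m', h1, h2, h3⟩

theorem IsCoverable.le_coveringNumber (hf : IsCoverable Γ f φ) {b : ℝ≥0}
    (h : ∀ g m, (g, m) ∈ coveringCone Γ φ → f ≤ g → b ≤ m) : b ≤ coveringNumber Γ f φ := by
  by_contra! hb
  obtain ⟨g, m, h1, h2, h3⟩ := hf.exists_lt hb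
  exact (h g m h1 h2).not_gt h3

theorem IsCoverable.add (hf : IsCoverable Γ f φ) (hg : IsCoverable Γ g φ) :
    IsCoverable Γ (f + g) φ :=
  let ⟨q, hq, hfq⟩ := hf
  let ⟨r, hr, hgr⟩ := hg
  ⟨q + r, add_mem hq hr, add_le_add hfq hgr⟩

theorem IsCoverable.smul (hf : IsCoverable Γ f φ) (c : ℝ≥0) : IsCoverable Γ (c • f) φ :=
  let ⟨q, hq, hfq⟩ := hf
  ⟨c • q, Submodule.smul_mem _ c hq, fun x => mul_le_mul_right (hfq x) c⟩

theorem coveringNumber_add_le (hf : IsCoverable Γ f φ) (hg : IsCoverable Γ g φ) :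
    coveringNumber Γ (f + g) φ ≤ coveringNumber Γ f φ + coveringNumber Γ g φ := by
  refine le_of_forall_pos_le_add fun ε hε => ?_
  have hε2 : 0 < ε / 2 := by positivity
  obtain ⟨q, m, hq, hfq, hm⟩ := hf.exists_lt (lt_add_of_pos_right _ hε2)
  obtain ⟨r, n, hr, hgr, hn⟩ := hg.exists_lt (lt_add_of_pos_right _ hε2)
  have h := coveringNumber_le (add_mem hq hr) (add_le_add hfq hgr)
  calc _ ≤ m + n := h
    _ ≤ (coveringNumber Γ f φ + ε / 2) + (coveringNumber Γ g φ + ε / 2) := add_le_add hm.le hn.le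
    _ = coveringNumber Γ f φ + coveringNumber Γ g φ + (ε / 2 + ε / 2) := by ring
    _ = _ := by rw [add_halves]

theorem coveringNumber_smul_le (hf : IsCoverable Γ f φ) (c : ℝ≥0) :
    coveringNumber Γ (c • f) φ ≤ c * coveringNumber Γ f φ := by
  rcases eq_or_ne c 0 with rfl | hc
  · refine (coveringNumber_le (zero_mem (coveringCone Γ φ)) ?_).trans (zero_le)
    intro x; simp
  · rw [← div_le_iff₀' (pos_iff_ne_zero.mpr hc)]
    refine hf.le_coveringNumber fun g m h1 h2 => ?_
    rw [div_le_iff₀' (pos_iff_ne_zero.mpr hc)]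
    exact coveringNumber_le (Submodule.smul_mem _ c h1) fun x => mul_le_mul_right (h2 x) c

theorem coveringNumber_smul (hf : IsCoverable Γ f φ) (c : ℝ≥0) :
    coveringNumber Γ (c • f) φ = c * coveringNumber Γ f φ := by
  refine le_antisymm (coveringNumber_smul_le hf c) ?_
  rcases eq_or_ne c 0 with rfl | hc
  · simp
  · have h := coveringNumber_smul_le (hf.smul c) c⁻¹
    rw [smul_smul, inv_mul_cancel₀ hc, one_smul] at h
    calc c * coveringNumber Γ f φ ≤ c * (c⁻¹ * coveringNumber Γ (c • f) φ) := mul_le_mul_right h c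
      _ = _ := by rw [← mul_assoc, mul_inv_cancel₀ hc, one_mul]

/-- Transport is linear, and a translate of a translate is the translate by a composite, which is
again in `Γ`. This is the source of invariance of covering numbers. -/
theorem push_mem_coveringCone (hΓ : IsPseudoStarGroup Γ) {γ : OpenPartialHomeomorph X X}
    (hγ : γ ∈ Γ) {q : (X → ℝ≥0) × ℝ≥0} (hq : q ∈ coveringCone Γ φ) :
    (γ.push q.1, q.2) ∈ coveringCone Γ φ := by
  induction hq using Submodule.span_induction with
  | mem q hq =>
    obtain ⟨γ', hγ', rfl⟩ := hq
    exact Submodule.subset_span ⟨γ'.trans γ, hΓ.trans_mem' hγ' hγ, by rw [push_push]⟩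
  | zero => rw [Prod.fst_zero, push_zero]; exact zero_mem _
  | add q r _ _ h1 h2 =>
    rw [Prod.fst_add, push_add]
    exact add_mem h1 h2
  | smul c q _ h1 =>
    rw [Prod.smul_fst, push_smul]
    exact Submodule.smul_mem _ c h1

theorem coveringNumber_push_le (hΓ : IsPseudoStarGroup Γ) {γ : OpenPartialHomeomorph X X}
    (hγ : γ ∈ Γ) (hf : IsCoverable Γ f φ) :
    coveringNumber Γ (γ.push f) φ ≤ coveringNumber Γ f φ :=
  hf.le_coveringNumber fun _ _ h1 h2 =>
    coveringNumber_le (push_mem_coveringCone hΓ hγ h1) (push_mono γ h2)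

/-- Substitution: in a combination of translates of `g`, each `g` is replaced by its own cover by
translates of `φ`, so the weights multiply. -/
theorem exists_mem_coveringCone_of_mem (hΓ : IsPseudoStarGroup Γ) {ψ : X → ℝ≥0} {m : ℝ≥0}
    (hψ : (ψ, m) ∈ coveringCone Γ φ) (hfψ : g ≤ ψ) {q : (X → ℝ≥0) × ℝ≥0}
    (hq : q ∈ coveringCone Γ g) : ∃ r ∈ coveringCone Γ φ, q.1 ≤ r.1 ∧ r.2 = q.2 * m := by
  induction hq using Submodule.span_induction with
  | mem q hq =>
    obtain ⟨γ, hγ, rfl⟩ := hq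
    exact ⟨_, push_mem_coveringCone hΓ hγ hψ, push_mono γ hfψ, by simp⟩
  | zero => exact ⟨0, zero_mem _, le_rfl, by simp⟩
  | add q q' _ _ h1 h2 =>
    obtain ⟨r, hr, h3, h4⟩ := h1
    obtain ⟨r', hr', h3', h4'⟩ := h2
    exact ⟨r + r', add_mem hr hr', add_le_add h3 h3', by simp [h4, h4', add_mul]⟩
  | smul c q _ h1 =>
    obtain ⟨r, hr, h3, h4⟩ := h1
    exact ⟨c • r, Submodule.smul_mem _ c hr, fun x => mul_le_mul_right (h3 x) c,
      by simp [h4, mul_assoc]⟩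

theorem IsCoverable.trans (hΓ : IsPseudoStarGroup Γ) (hf : IsCoverable Γ f g)
    (hg : IsCoverable Γ g φ) : IsCoverable Γ f φ := by
  obtain ⟨q, hq, hfq⟩ := hf
  obtain ⟨r, hr, hgr⟩ := hg
  obtain ⟨s, hs, h1, -⟩ := exists_mem_coveringCone_of_mem hΓ hr hgr hq
  exact ⟨s, hs, hfq.trans h1⟩

theorem coveringNumber_le_mul (hΓ : IsPseudoStarGroup Γ) (hf : IsCoverable Γ f g)
    (hg : IsCoverable Γ g φ) :
    coveringNumber Γ f φ ≤ coveringNumber Γ f g * coveringNumber Γ g φ := by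
  have key : ∀ q m r n, (q, m) ∈ coveringCone Γ g → f ≤ q → (r, n) ∈ coveringCone Γ φ → g ≤ r →
      coveringNumber Γ f φ ≤ m * n := by
    intro q m r n hq hfq hr hgr
    obtain ⟨s, hs, h1, h2⟩ := exists_mem_coveringCone_of_mem hΓ hr hgr hq
    exact h2 ▸ coveringNumber_le (g := s.1) (m := s.2) hs (hfq.trans h1)
  have key' : ∀ q m, (q, m) ∈ coveringCone Γ g → f ≤ q →
      coveringNumber Γ f φ ≤ m * coveringNumber Γ g φ := by
    intro q m hq hfq
    -- The infimum is reached by dividing by the other factor, so a vanishing factor is treated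
    -- separately.
    rcases eq_or_ne m 0 with rfl | hm
    · obtain ⟨r, hr, hgr⟩ := hg
      simpa using key q 0 r.1 r.2 hq hfq hr hgr
    · rw [← div_le_iff₀' (pos_iff_ne_zero.mpr hm)]
      refine hg.le_coveringNumber fun r n hr hgr => ?_
      rw [div_le_iff₀' (pos_iff_ne_zero.mpr hm)]
      exact key q m r n hq hfq hr hgr
  rcases eq_or_ne (coveringNumber Γ g φ) 0 with h0 | h0
  · obtain ⟨q, hq, hfq⟩ := hf
    simpa [h0] using key' q.1 q.2 hq hfq
  · rw [← div_le_iff₀ (pos_iff_ne_zero.mpr h0)]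
    refine hf.le_coveringNumber fun q m hq hfq => ?_
    rw [div_le_iff₀ (pos_iff_ne_zero.mpr h0)]
    exact key' q m hq hfq

/-- No translate of `φ` exceeds `1`, so the value of a combination at a point is at most its total
weight. This keeps the normalizing denominators positive. -/
theorem le_coveringNumber_of_le_one (hφ : φ ≤ 1) (hf : IsCoverable Γ f φ) (x : X) :
    f x ≤ coveringNumber Γ f φ := by
  have key : ∀ q ∈ coveringCone Γ φ, q.1 x ≤ q.2 := by
    intro q hq
    induction hq using Submodule.span_induction with
    | mem q hq =>
      obtain ⟨γ, hγ, rfl⟩ := hq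
      by_cases hx : x ∈ γ.target
      · simpa [push_of_mem _ _ hx] using hφ _
      · simp [push_of_notMem _ _ hx]
    | zero => simp
    | add q r _ _ h1 h2 => exact add_le_add h1 h2
    | smul c q _ h1 => exact mul_le_mul_right h1 c
  exact hf.le_coveringNumber fun g m h1 h2 => (h2 x).trans (key _ h1)

/-- If every orbit meets a set where `φ` is positive, then functions with compact support
are dominated by translates of `φ`. -/
theorem isCoverable_of_hasCompactSupport (hΓ : IsPseudoStarGroup Γ)
    (hmin : ∀ (x : X) (U : Set X), IsOpen U → U.Nonempty → ∃ γ ∈ Γ, x ∈ γ.source ∧ γ x ∈ U)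
    {U : Set X} (hU : IsOpen U) (hU' : U.Nonempty) {c : ℝ≥0} (hc : c ≠ 0) (hcU : ∀ x ∈ U, c ≤ φ x)
    (hf : Continuous f) (hfc : HasCompactSupport f) : IsCoverable Γ f φ := by
  have h1 : ∃ q ∈ coveringCone Γ φ, ∀ x ∈ tsupport f, 1 ≤ q.1 x := by
    refine IsCompact.induction_on (p := fun s => ∃ q ∈ coveringCone Γ φ, ∀ x ∈ s, 1 ≤ q.1 x)
      hfc.isCompact ⟨0, zero_mem _, by simp⟩ ?_ ?_ ?_
    · rintro s t hst ⟨q, hq, h⟩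
      exact ⟨q, hq, fun x hx => h x (hst hx)⟩
    · rintro s t ⟨q, hq, h⟩ ⟨r, hr, h'⟩
      refine ⟨q + r, add_mem hq hr, ?_⟩
      rintro x (hx | hx)
      · exact (h x hx).trans (le_self_add)
      · exact (h' x hx).trans (le_add_self)
    · intro x _
      obtain ⟨γ, hγ, hx, hxU⟩ := hmin x U hU hU'
      -- Pulling `φ` back by a map that carries `x` into `U` gives a translate that is at least `c`
      -- near `x`; the weight `c⁻¹` raises it to `1`.
      refine ⟨γ.source ∩ γ ⁻¹' U, mem_nhdsWithin_of_mem_nhds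
        ((γ.isOpen_inter_preimage hU).mem_nhds ⟨hx, hxU⟩), c⁻¹ • (γ.symm.push φ, 1),
        Submodule.smul_mem _ _ (Submodule.subset_span ⟨_, hΓ.symm_mem _ hγ, rfl⟩), ?_⟩
      rintro y ⟨hy, hyU⟩
      have : γ.symm.push φ y = φ (γ y) := by
        rw [push_of_mem _ _ (by simpa using hy)]; simp
      have h2 : c⁻¹ * c ≤ c⁻¹ * φ (γ y) := mul_le_mul_right (hcU (γ y) hyU) c⁻¹
      rw [inv_mul_cancel₀ hc, ← this] at h2
      exact h2
  obtain ⟨q, hq, h⟩ := h1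
  obtain ⟨C, hC⟩ : ∃ C : ℝ≥0, ∀ x, f x ≤ C := by
    obtain ⟨C, hC⟩ := (hfc.isCompact_range hf).bddAbove
    exact ⟨C, fun x => hC ⟨x, rfl⟩⟩
  refine ⟨C • q, Submodule.smul_mem _ _ hq, fun x => ?_⟩
  by_cases hx : x ∈ tsupport f
  · have h2 : C * 1 ≤ C * q.1 x := mul_le_mul_right (h x hx) C
    rw [mul_one] at h2
    exact (hC x).trans h2
  · rw [image_eq_zero_of_notMem_tsupport hx]; exact zero_le

end Covering

/-! ### Almost additivity of covering numbers for narrow test functions -/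

section CoveringLimit

variable {X : Type*} [MetricSpace X] {Γ : Set (OpenPartialHomeomorph X X)}

/-- The only delicate points are zeros of the denominator. There `w` vanishes, so nearby `w < 1`,
which forces `g = 0` and `f = 0`; the quotient is then locally `0`, also where it reads `0 / 0`. -/
theorem continuous_div_add_smul {f g w : X → ℝ≥0} {η : ℝ≥0} (hη : η ≠ 0) (hf : Continuous f)
    (hg : Continuous g) (hw : Continuous w) (hfg : f ≤ g) (h1 : ∀ x, g x ≠ 0 → w x = 1) :
    Continuous fun x => f x / (g x + η * w x) := by
  rw [continuous_iff_continuousAt]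
  intro x
  by_cases hx : g x + η * w x = 0
  · have hwx : w x < 1 := by
      have := (add_eq_zero.mp hx).2
      rcases mul_eq_zero.mp this with h | h
      · exact absurd h hη
      · rw [h]; exact one_pos
    have hev : ∀ᶠ y in 𝓝 x, f y / (g y + η * w y) = 0 := by
      filter_upwards [hw.continuousAt.eventually (gt_mem_nhds hwx)] with y hy
      have hgy : g y = 0 := by
        by_contra h
        exact hy.ne (h1 y h)
      have : f y = 0 := le_antisymm (hgy ▸ hfg y) zero_le
      rw [this, zero_div]
    exact continuousAt_const.congr (hev.mono fun y hy => hy.symm)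
  · exact hf.continuousAt.div (by fun_prop) hx

theorem exists_uniform_of_hasCompactSupport {u : X → ℝ≥0} (hu : Continuous u)
    (hc : HasCompactSupport u) {η : ℝ≥0} (hη : 0 < η) :
    ∃ ε > 0, ∀ x y, dist x y < ε → u x ≤ u y + η := by
  have hcont : UniformContinuous u := hu.uniformContinuous_of_tendsto_cocompact
    (x := 0) hc.is_zero_at_infty
  obtain ⟨ε, hε, h⟩ := Metric.uniformContinuous_iff.mp hcont η hη
  refine ⟨ε, hε, fun x y hxy => ?_⟩
  have := h hxy
  rw [NNReal.dist_eq] at this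
  rw [← NNReal.coe_le_coe, NNReal.coe_add]
  linarith [le_abs_self ((u x : ℝ) - u y)]

/-- The quotients `u₁`, `u₂` of `f₁`, `f₂` by `f₁ + f₂ + η • w` are uniformly continuous with sum at
most `1`. On a narrow translate of `φ` they are constant up to `η`, so multiplying a cover of the
denominator by them gives covers of `f₁` and `f₂` whose weights add up to at most `1 + 2 * η` times
the original one. Equicontinuity makes all translates narrow at once. -/
theorem exists_coveringNumber_add_le
    (heq : ∀ ε > 0, ∃ δ > 0, ∀ γ ∈ Γ, ∀ x ∈ γ.source, ∀ x' ∈ γ.source,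
      dist x x' < δ → dist (γ x) (γ x') ≤ ε)
    {f₁ f₂ w : X → ℝ≥0} (h₁ : Continuous f₁) (h₂ : Continuous f₂) (hc₁ : HasCompactSupport f₁)
    (hc₂ : HasCompactSupport f₂) (hw : Continuous w) (hfw : ∀ x, (f₁ + f₂) x ≠ 0 → w x = 1)
    {η : ℝ≥0} (hη : 0 < η) :
    ∃ δ > 0, ∀ φ : X → ℝ≥0, (∀ x x', φ x ≠ 0 → φ x' ≠ 0 → dist x x' < δ) →
      IsCoverable Γ (f₁ + f₂ + η • w) φ →
      coveringNumber Γ f₁ φ + coveringNumber Γ f₂ φ ≤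
        (1 + 2 * η) * coveringNumber Γ (f₁ + f₂ + η • w) φ := by
  set F := f₁ + f₂ + η • w with hF
  have hFx : ∀ x, F x = (f₁ + f₂) x + η * w x := fun x => rfl
  set u₁ : X → ℝ≥0 := fun x => f₁ x / F x with hu₁
  set u₂ : X → ℝ≥0 := fun x => f₂ x / F x with hu₂
  have hc1 : Continuous u₁ := continuous_div_add_smul hη.ne' h₁ (h₁.add h₂) hw
    (fun x => by simp) hfw
  have hc2 : Continuous u₂ := continuous_div_add_smul hη.ne' h₂ (h₁.add h₂) hw
    (fun x => by simp) hfw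
  have hs1 : HasCompactSupport u₁ := hc₁.mono fun x hx h => hx (by simp [hu₁, h])
  have hs2 : HasCompactSupport u₂ := hc₂.mono fun x hx h => hx (by simp [hu₂, h])
  obtain ⟨ε₁, hε₁, hue₁⟩ := exists_uniform_of_hasCompactSupport hc1 hs1 hη
  obtain ⟨ε₂, hε₂, hue₂⟩ := exists_uniform_of_hasCompactSupport hc2 hs2 hη
  have hle : ∀ x, u₁ x + u₂ x ≤ 1 := fun x => by
    rw [hu₁, hu₂]
    simp only
    rw [← add_div]
    refine div_le_one_of_le₀ ?_ zero_le
    rw [hFx]; exact le_self_add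
  have hmul : ∀ (f : X → ℝ≥0), f ≤ f₁ + f₂ → ∀ x, f x / F x * F x = f x := fun f hf x => by
    rcases eq_or_ne (F x) 0 with h | h
    · have : f x ≤ 0 := (hf x).trans ((le_self_add).trans ((hFx x).symm.trans h).le)
      rw [h, mul_zero, le_antisymm this zero_le]
    · exact div_mul_cancel₀ _ h
  -- The half turns the weak inequality of equicontinuity into the strict one needed for uniform
  -- continuity.
  obtain ⟨δ, hδ, heqδ⟩ := heq (min ε₁ ε₂ / 2) (by positivity)
  refine ⟨δ, hδ, fun φ hφ hcov => ?_⟩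
  have key : ∀ q ∈ coveringCone Γ φ, ∃ q₁ ∈ coveringCone Γ φ, ∃ q₂ ∈ coveringCone Γ φ,
      u₁ * q.1 ≤ q₁.1 ∧ u₂ * q.1 ≤ q₂.1 ∧ q₁.2 + q₂.2 ≤ (1 + 2 * η) * q.2 := by
    intro q hq
    induction hq using Submodule.span_induction with
    | mem q hq =>
      obtain ⟨γ, hγ, rfl⟩ := hq
      have hmem : (γ.push φ, 1) ∈ coveringCone Γ φ := Submodule.subset_span ⟨γ, hγ, rfl⟩
      by_cases h0 : ∃ y₀, γ.push φ y₀ ≠ 0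
      · obtain ⟨y₀, hy₀⟩ := h0
        have hclose : ∀ y, γ.push φ y ≠ 0 → dist y y₀ < ε₁ ∧ dist y y₀ < ε₂ := by
          intro y hy
          obtain ⟨x, ⟨hx, hxs⟩, rfl⟩ := support_push_subset γ φ hy
          obtain ⟨x₀, ⟨hx₀, hxs₀⟩, rfl⟩ := support_push_subset γ φ hy₀
          have h3 := heqδ γ hγ x hxs x₀ hxs₀ (hφ x x₀ hx hx₀)
          have h4 : 0 < min ε₁ ε₂ := by positivity
          exact ⟨by linarith [min_le_left ε₁ ε₂], by linarith [min_le_right ε₁ ε₂]⟩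
        -- The value at one point `y₀` of the translate, plus `η`, bounds each `uᵢ` on the whole
        -- translate.
        refine ⟨(u₁ y₀ + η) • (γ.push φ, 1), Submodule.smul_mem _ _ hmem,
          (u₂ y₀ + η) • (γ.push φ, 1), Submodule.smul_mem _ _ hmem, fun y => ?_, fun y => ?_, ?_⟩
        · by_cases hy : γ.push φ y = 0
          · simp [hy]
          · exact mul_le_mul_left (hue₁ _ _ (hclose y hy).1) _
        · by_cases hy : γ.push φ y = 0
          · simp [hy]
          · exact mul_le_mul_left (hue₂ _ _ (hclose y hy).2) _
        · simp only [Prod.smul_mk, smul_eq_mul, mul_one]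
          calc u₁ y₀ + η + (u₂ y₀ + η) = (u₁ y₀ + u₂ y₀) + 2 * η := by ring
            _ ≤ _ := add_le_add_left (hle y₀) _
      · push Not at h0
        exact ⟨0, zero_mem _, 0, zero_mem _, fun y => by simp [h0], fun y => by simp [h0], by simp⟩
    | zero => exact ⟨0, zero_mem _, 0, zero_mem _, by simp, by simp, by simp⟩
    | add q r _ _ ih1 ih2 =>
      obtain ⟨q₁, hq₁, q₂, hq₂, a, b, c⟩ := ih1
      obtain ⟨r₁, hr₁, r₂, hr₂, a', b', c'⟩ := ih2
      refine ⟨q₁ + r₁, add_mem hq₁ hr₁, q₂ + r₂, add_mem hq₂ hr₂, ?_, ?_, ?_⟩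
      · rw [Prod.fst_add, mul_add]; exact add_le_add a a'
      · rw [Prod.fst_add, mul_add]; exact add_le_add b b'
      · simp only [Prod.snd_add]
        rw [mul_add, add_add_add_comm]; exact add_le_add c c'
    | smul t q _ ih =>
      obtain ⟨q₁, hq₁, q₂, hq₂, a, b, c⟩ := ih
      refine ⟨t • q₁, Submodule.smul_mem _ _ hq₁, t • q₂, Submodule.smul_mem _ _ hq₂, fun y => ?_,
        fun y => ?_, ?_⟩
      · have := mul_le_mul_right (a y) t
        simpa [mul_left_comm] using this
      · have := mul_le_mul_right (b y) t
        simpa [mul_left_comm] using this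
      · simp only [Prod.smul_snd, smul_eq_mul]
        rw [← mul_add, mul_left_comm]
        exact mul_le_mul_right c t
  have h0 : (0 : ℝ≥0) < 1 + 2 * η := by positivity
  rw [← div_le_iff₀' h0]
  refine hcov.le_coveringNumber fun g m hg hFg => ?_
  rw [div_le_iff₀' h0]
  obtain ⟨q₁, hq₁, q₂, hq₂, a, b, c⟩ := key _ hg
  have hf : ∀ (f : X → ℝ≥0), f ≤ f₁ + f₂ → f ≤ (fun x => f x / F x) * g := fun f hf x => by
    calc f x = f x / F x * F x := (hmul f hf x).symm
      _ ≤ _ := mul_le_mul_right (hFg x) _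
  refine (add_le_add (coveringNumber_le (g := q₁.1) (m := q₁.2) hq₁ ?_)
    (coveringNumber_le (g := q₂.1) (m := q₂.2) hq₂ ?_)).trans c
  · exact (hf f₁ fun x => by simp).trans a
  · exact (hf f₂ fun x => by simp).trans b

end CoveringLimit

section Bump

variable {X : Type*} [TopologicalSpace X] [T2Space X] [LocallyCompactSpace X]

theorem exists_bump {K U : Set X} (hK : IsCompact K) (hU : IsOpen U) (hKU : K ⊆ U) :
    ∃ f : C_c(X, ℝ≥0), tsupport f ⊆ U ∧ (∀ x ∈ K, f x = 1) ∧ ∀ x, f x ≤ 1 := by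
  obtain ⟨f, h1, h2, h3, h4⟩ := exists_continuous_sum_one_of_isOpen_isCompact (n := 1)
    (s := fun _ => U) (fun _ => hU) hK (hKU.trans (subset_iUnion (fun _ : Fin 1 => U) 0))
  have hsupp : Function.support (fun x => (f 0 x).toNNReal) ⊆ Function.support (f 0) := by
    intro x hx h
    exact hx (by simp [h])
  refine ⟨⟨⟨fun x => (f 0 x).toNNReal, by fun_prop⟩, (h4 0).mono hsupp⟩,
    (closure_mono hsupp).trans (h1 0), fun x hx => ?_, fun x => ?_⟩
  · have : f 0 x = 1 := by simpa using h2 hx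
    change (f 0 x).toNNReal = 1
    rw [this, Real.toNNReal_one]
  · change (f 0 x).toNNReal ≤ 1
    exact Real.toNNReal_le_one.mpr (h3 0 x).2

end Bump

/-! ### The limit functional -/

section Existence

variable {X : Type*} [MetricSpace X] [LocallyCompactSpace X] [Nonempty X]
  {Γ : Set (OpenPartialHomeomorph X X)}

/-- The functional obtained as a limit of normalized covering numbers. -/
theorem exists_invariant_functional (hΓ : IsPseudoStarGroup Γ)
    (heq : ∀ ε > 0, ∃ δ > 0, ∀ γ ∈ Γ, ∀ x ∈ γ.source, ∀ x' ∈ γ.source,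
      dist x x' < δ → dist (γ x) (γ x') ≤ ε)
    (hmin : ∀ (x : X) (U : Set X), IsOpen U → U.Nonempty → ∃ γ ∈ Γ, x ∈ γ.source ∧ γ x ∈ U) :
    ∃ Λ : C_c(X, ℝ≥0) →ₗ[ℝ≥0] ℝ≥0, Λ ≠ 0 ∧
      ∀ γ ∈ Γ, ∀ f g : C_c(X, ℝ≥0), tsupport f ⊆ γ.source → (g : X → ℝ≥0) = γ.push f →
        Λ g = Λ f := by
  classical
  obtain ⟨x₀⟩ := ‹Nonempty X›
  obtain ⟨f₀, -, hf₀, -⟩ := exists_bump (isCompact_singleton (x := x₀)) isOpen_univ (subset_univ _)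
  have hf₀x : f₀ x₀ = 1 := hf₀ x₀ rfl
  -- Test functions need not be continuous; only their size and narrowness enter.
  set φ : ℕ → X → ℝ≥0 := fun n => (Metric.ball x₀ (1 / ((n : ℝ) + 1))).indicator 1 with hφ
  have hφ1 : ∀ n, φ n ≤ 1 := fun n x => indicator_le_self' (by simp) x
  have hcov : ∀ n (f : C_c(X, ℝ≥0)), IsCoverable Γ f (φ n) := fun n f =>
    isCoverable_of_hasCompactSupport hΓ hmin (U := Metric.ball x₀ (1 / ((n : ℝ) + 1)))
      Metric.isOpen_ball ⟨x₀, Metric.mem_ball_self (by positivity)⟩ one_ne_zero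
      (fun x hx => (indicator_of_mem hx (1 : X → ℝ≥0)).ge) f.continuous f.hasCompactSupport
  have hcov₀ : ∀ f : C_c(X, ℝ≥0), IsCoverable Γ f f₀ := fun f =>
    isCoverable_of_hasCompactSupport hΓ hmin (U := {x | 1 / 2 < f₀ x})
      (isOpen_lt continuous_const f₀.continuous) ⟨x₀, by
        change 1 / 2 < f₀ x₀
        rw [hf₀x]; exact NNReal.half_lt_self one_ne_zero⟩ (c := 1 / 2) (by positivity)
      (fun x hx => le_of_lt hx) f.continuous f.hasCompactSupport
  have hpos : ∀ n, 0 < coveringNumber Γ f₀ (φ n) := fun n =>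
    one_pos.trans_le (hf₀x ▸ le_coveringNumber_of_le_one (hφ1 n) (hcov n f₀) x₀)
  set J : ℕ → (X → ℝ≥0) → ℝ≥0 := fun n f => coveringNumber Γ f (φ n) / coveringNumber Γ f₀ (φ n)
    with hJ
  -- An ultrafilter gives limits for all `f` simultaneously, since each ratio is bounded by `(f :
  -- f₀)`.
  have hlim : ∀ f : C_c(X, ℝ≥0), ∃ l, Tendsto (fun n => J n f) (hyperfilter ℕ) (𝓝 l) := by
    intro f
    have hle : ∀ n, J n f ∈ Icc 0 (coveringNumber Γ f f₀) := fun n =>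
      ⟨zero_le, (div_le_iff₀ (hpos n)).mpr (coveringNumber_le_mul hΓ (hcov₀ f) (hcov n f₀))⟩
    obtain ⟨l, -, hl⟩ := (isCompact_Icc (a := (0 : ℝ≥0)) (b := coveringNumber Γ f f₀)
      ).ultrafilter_le_nhds ((hyperfilter ℕ).map fun n => J n f)
      (tendsto_principal.mpr (Eventually.of_forall hle))
    exact ⟨l, hl⟩
  choose Λ hΛ using hlim
  have hle_add : ∀ f g, Λ (f + g) ≤ Λ f + Λ g := fun f g =>
    le_of_tendsto_of_tendsto' (hΛ _) ((hΛ f).add (hΛ g)) fun n => by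
      simp only [hJ]
      rw [← add_div]
      exact div_le_div_of_nonneg_right (coveringNumber_add_le (hcov n f) (hcov n g)) zero_le
  have hsmul : ∀ (c : ℝ≥0) f, Λ (c • f) = c * Λ f := fun c f =>
    tendsto_nhds_unique (hΛ _) (((hΛ f).const_mul c).congr fun n => by
      simp only [hJ]
      rw [← mul_div_assoc, ← coveringNumber_smul (hcov n f) c]; rfl)
  have hadd_le : ∀ f g, Λ f + Λ g ≤ Λ (f + g) := by
    intro f g
    obtain ⟨w, -, hw, -⟩ := exists_bump (f + g).hasCompactSupport.isCompact isOpen_univ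
      (subset_univ _)
    -- Almost additivity survives the limit in `n`; the error terms then vanish as `η` tends to `0`.
    have key : ∀ η : ℝ≥0, 0 < η → Λ f + Λ g ≤ (1 + 2 * η) * (Λ (f + g) + η * Λ w) := by
      intro η hη
      obtain ⟨δ, hδ, h⟩ := exists_coveringNumber_add_le heq f.continuous g.continuous
        f.hasCompactSupport g.hasCompactSupport w.continuous
        (fun x hx => hw x (subset_tsupport _ hx)) hη
      have hev : ∀ᶠ n in (hyperfilter ℕ : Filter ℕ),
          J n f + J n g ≤ (1 + 2 * η) * (J n (f + g : C_c(X, ℝ≥0)) + η * J n w) := by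
        have hsmall : ∀ᶠ n : ℕ in atTop, 1 / ((n : ℝ) + 1) < δ / 2 :=
          tendsto_one_div_add_atTop_nhds_zero_nat.eventually (gt_mem_nhds (half_pos hδ))
        filter_upwards [Nat.hyperfilter_le_atTop hsmall] with n hn
        have hball : ∀ x, φ n x ≠ 0 → dist x x₀ < 1 / ((n : ℝ) + 1) := fun x hx => by
          by_contra hx'
          exact hx (indicator_of_notMem (by simpa using hx') _)
        have h1 := h (φ n) (fun x x' hx hx' => by
          have := dist_triangle_right x x' x₀
          linarith [hball x hx, hball x' hx']) (hcov n (f + g + η • w))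
        have h2 : coveringNumber Γ (⇑f + ⇑g + η • ⇑w) (φ n) ≤
            coveringNumber Γ (f + g : C_c(X, ℝ≥0)) (φ n) + η * coveringNumber Γ w (φ n) := by
          rw [← coveringNumber_smul (hcov n w) η]
          exact coveringNumber_add_le (hcov n (f + g)) (hcov n (η • w))
        simp only [hJ]
        rw [← add_div, ← mul_div_assoc, ← add_div, ← mul_div_assoc]
        exact div_le_div_of_nonneg_right (h1.trans (mul_le_mul_right h2 _)) zero_le
      exact le_of_tendsto_of_tendsto ((hΛ f).add (hΛ g))
        (((hΛ (f + g)).add ((hΛ w).const_mul η)).const_mul (1 + 2 * η)) hev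
    have hcont : Tendsto (fun η : ℝ≥0 => (1 + 2 * η) * (Λ (f + g) + η * Λ w)) (𝓝[>] 0)
        (𝓝 ((1 + 2 * 0) * (Λ (f + g) + 0 * Λ w))) :=
      (Continuous.tendsto (by fun_prop) 0).mono_left nhdsWithin_le_nhds
    simp only [mul_zero, add_zero, one_mul, zero_mul] at hcont
    exact ge_of_tendsto hcont (eventually_mem_nhdsWithin.mono key)
  refine ⟨{ toFun := Λ, map_add' := fun f g => le_antisymm (hle_add f g) (hadd_le f g),
            map_smul' := hsmul }, ?_, ?_⟩
  · intro h
    have h1 : Λ f₀ = 0 := LinearMap.congr_fun h f₀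
    have h2 : Λ f₀ = 1 := tendsto_nhds_unique (hΛ f₀) (tendsto_const_nhds.congr fun n =>
      (div_self (hpos n).ne').symm)
    exact one_ne_zero (h2.symm.trans h1)
  · intro γ hγ f g hf hg
    have hgf : γ.symm.push (g : X → ℝ≥0) = f := by
      rw [hg, push_symm_push γ ((subset_tsupport _).trans hf)]
    refine tendsto_nhds_unique (hΛ g) ((hΛ f).congr fun n => ?_)
    simp only [hJ]
    congr 1
    refine le_antisymm ?_ ?_
    -- Transport does not increase covering numbers; applying this to `γ` and to its inverse gives
    -- equality.
    · conv_lhs => rw [← hgf]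
      exact coveringNumber_push_le hΓ (hΓ.symm_mem _ hγ) (hcov n g)
    · conv_lhs => rw [hg]
      exact coveringNumber_push_le hΓ hγ (hcov n f)

end Existence

/-! ### Invariance of measures, and its local nature -/

section Invariance

variable {X : Type*} [TopologicalSpace X] [MeasurableSpace X]

/-- A measure is left invariant by `γ` if the integrals of functions with compact support in the
domain of `γ` are. -/
def IntegralInvariant (μ : Measure X) (γ : OpenPartialHomeomorph X X) : Prop :=
  ∀ ζ : X → ℝ, Continuous ζ → HasCompactSupport ζ → tsupport ζ ⊆ γ.source →
    ∫ y in γ.target, ζ (γ.symm y) ∂μ = ∫ x, ζ x ∂μ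

variable [BorelSpace X]

theorem setIntegral_target_eq (μ : Measure X) (γ : OpenPartialHomeomorph X X) (ζ : X → ℝ) :
    ∫ y in γ.target, ζ (γ.symm y) ∂μ = ∫ y, γ.push ζ y ∂μ :=
  (integral_indicator γ.open_target.measurableSet).symm

theorem integralInvariant_iff {μ : Measure X} {γ : OpenPartialHomeomorph X X} :
    IntegralInvariant μ γ ↔ ∀ ζ : X → ℝ, Continuous ζ → HasCompactSupport ζ →
      tsupport ζ ⊆ γ.source → ∫ y, γ.push ζ y ∂μ = ∫ x, ζ x ∂μ := by
  simp only [IntegralInvariant, setIntegral_target_eq]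

variable [T2Space X] {μ : Measure X} [IsFiniteMeasureOnCompacts μ]

/-- Positive and negative parts are transported separately. This passes from the cone of nonnegative
functions, where the Riesz functional lives, to real functions. -/
theorem integralInvariant_of_nnreal {γ : OpenPartialHomeomorph X X}
    (h : ∀ f g : C_c(X, ℝ≥0), tsupport f ⊆ γ.source → (g : X → ℝ≥0) = γ.push f →
      ∫ x, (g x : ℝ) ∂μ = ∫ x, (f x : ℝ) ∂μ) : IntegralInvariant μ γ := by
  rw [integralInvariant_iff]
  intro ζ hζ hc hs
  have key : ∀ θ : X → ℝ, Continuous θ → HasCompactSupport θ → tsupport θ ⊆ γ.source →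
      Integrable (fun x => ((θ x).toNNReal : ℝ)) μ ∧
      Integrable (fun x => ((γ.push (fun x => (θ x).toNNReal) x : ℝ≥0) : ℝ)) μ ∧
      ∫ x, ((γ.push (fun x => (θ x).toNNReal) x : ℝ≥0) : ℝ) ∂μ =
        ∫ x, ((θ x).toNNReal : ℝ) ∂μ := by
    intro θ hθ hθc hθs
    have hsub : Function.support (fun x => (θ x).toNNReal) ⊆ Function.support θ :=
      fun x hx h => hx (by simp [h])
    have h1 : Continuous fun x => (θ x).toNNReal := by fun_prop
    have h2 : HasCompactSupport fun x => (θ x).toNNReal := hθc.mono hsub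
    have h3 : tsupport (fun x => (θ x).toNNReal) ⊆ γ.source := (closure_mono hsub).trans hθs
    have h4 := continuous_push γ h1 h2 h3
    have h5 := hasCompactSupport_push γ h2 h3
    refine ⟨?_, ?_, h ⟨⟨_, h1⟩, h2⟩ ⟨⟨_, h4⟩, h5⟩ h3 rfl⟩
    · exact (NNReal.continuous_coe.comp h1).integrable_of_hasCompactSupport
        (h2.comp_left (g := fun r : ℝ≥0 => (r : ℝ)) rfl)
    · exact (NNReal.continuous_coe.comp h4).integrable_of_hasCompactSupport
        (h5.comp_left (g := fun r : ℝ≥0 => (r : ℝ)) rfl)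
  have hneg : Function.support (-ζ) = Function.support ζ := Function.support_neg ζ
  obtain ⟨a1, a2, a3⟩ := key ζ hζ hc hs
  obtain ⟨b1, b2, b3⟩ := key (-ζ) hζ.neg hc.neg (by rwa [tsupport, hneg])
  have hsub : ∀ r : ℝ, r = (r.toNNReal : ℝ) - ((-r).toNNReal : ℝ) := fun r => by
    simp [Real.coe_toNNReal', max_zero_sub_max_neg_zero_eq_self]
  have e1 : ζ = fun x => ((ζ x).toNNReal : ℝ) - (((-ζ) x).toNNReal : ℝ) :=
    funext fun x => hsub (ζ x)
  have e2 : γ.push ζ = fun x => ((γ.push (fun x => (ζ x).toNNReal) x : ℝ≥0) : ℝ) -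
      ((γ.push (fun x => ((-ζ) x).toNNReal) x : ℝ≥0) : ℝ) := by
    funext y
    by_cases hy : y ∈ γ.target
    · simp only [push_of_mem _ _ hy]
      exact hsub _
    · simp [push_of_notMem _ _ hy]
  rw [e2, integral_sub a2 b2, a3, b3, ← integral_sub a1 b1]
  exact integral_congr_ae (Eventually.of_forall fun x => (hsub (ζ x)).symm)

/-- A measure invariant under a family of maps is invariant under all maps that belong to this
family locally. -/
theorem integralInvariant_of_local [LocallyCompactSpace X] {Γ : Set (OpenPartialHomeomorph X X)}
    (hΓ : ∀ γ ∈ Γ, IntegralInvariant μ γ) {γ : OpenPartialHomeomorph X X}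
    (hγ : ∀ x ∈ γ.source, ∃ γ' ∈ Γ, x ∈ γ'.source ∧ γ'.source ⊆ γ.source ∧ EqOn γ' γ γ'.source) :
    IntegralInvariant μ γ := by
  rw [integralInvariant_iff]
  intro ζ hζ hc hs
  -- Supplies `choose!` with a default value at points outside the domain of `γ`.
  have : Nonempty (OpenPartialHomeomorph X X) := ⟨γ⟩
  choose! G hGΓ hxG hGs hGe using hγ
  obtain ⟨t, ht, htc⟩ := hc.isCompact.elim_nhds_subcover (fun x => (G x).source)
    (fun x hx => (G x).open_source.mem_nhds (hxG x (hs hx)))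
  have e := t.equivFin.symm
  obtain ⟨χ, hχs, hχ1, -, hχc⟩ := exists_continuous_sum_one_of_isOpen_isCompact
    (s := fun i => (G (e i)).source) (fun i => (G (e i)).open_source) hc.isCompact (by
      intro x hx
      obtain ⟨y, hy, hxy⟩ := mem_iUnion₂.mp (htc hx)
      exact mem_iUnion.mpr ⟨e.symm ⟨y, hy⟩, by simpa using hxy⟩)
  have hsum : ∀ x, ζ x = ∑ i, χ i x * ζ x := fun x => by
    rw [← Finset.sum_mul]
    by_cases hx : x ∈ tsupport ζ
    · have := hχ1 hx
      simp only [Finset.sum_apply, Pi.one_apply] at this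
      rw [this, one_mul]
    · rw [image_eq_zero_of_notMem_tsupport hx, mul_zero]
  have hcont : ∀ i, Continuous fun x => χ i x * ζ x := fun i => (χ i).continuous.mul hζ
  have hcomp : ∀ i, HasCompactSupport fun x => χ i x * ζ x := fun i => (hχc i).mul_right
  have hsupp : ∀ i, tsupport (fun x => χ i x * ζ x) ⊆ (G (e i)).source := fun i =>
    (closure_mono (Function.support_mul_subset_left (χ i) ζ)).trans (hχs i)
  have hmem : ∀ i, (e i : X) ∈ γ.source := fun i => hs (ht _ (e i).2)
  -- Each piece of `ζ` is supported where `γ` agrees with a member of `Γ`, so both transport it in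
  -- the same way.
  have hpush : ∀ i, γ.push (fun x => χ i x * ζ x) = (G (e i)).push fun x => χ i x * ζ x := by
    intro i
    ext y
    by_cases hy : y ∈ (G (e i)).target
    · have hx := (G (e i)).map_target hy
      rw [push_of_mem _ _ hy]
      conv_lhs => rw [← (G (e i)).right_inv hy, hGe _ (hmem i) hx]
      exact push_apply_map _ _ (hGs _ (hmem i) hx)
    · rw [push_of_notMem _ _ hy]
      by_contra hne
      obtain ⟨x, ⟨hx, -⟩, rfl⟩ := support_push_subset _ _ hne
      have hxs := hsupp i (subset_tsupport _ hx)
      exact hy (hGe _ (hmem i) hxs ▸ (G (e i)).map_source hxs)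
  have hsum' : ∀ y, γ.push ζ y = ∑ i, (G (e i)).push (fun x => χ i x * ζ x) y := fun y => by
    simp only [← hpush]
    by_cases hy : y ∈ γ.target
    · simp only [push_of_mem _ _ hy]
      exact hsum _
    · simp [push_of_notMem _ _ hy]
  calc ∫ y, γ.push ζ y ∂μ = ∫ y, ∑ i, (G (e i)).push (fun x => χ i x * ζ x) y ∂μ :=
        integral_congr_ae (Eventually.of_forall hsum')
    _ = ∑ i, ∫ y, (G (e i)).push (fun x => χ i x * ζ x) y ∂μ :=
        integral_finsetSum _ fun i _ =>
          (continuous_push _ (hcont i) (hcomp i) (hsupp i)).integrable_of_hasCompactSupport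
            (hasCompactSupport_push _ (hcomp i) (hsupp i))
    _ = ∑ i, ∫ x, χ i x * ζ x ∂μ := Finset.sum_congr rfl fun i _ =>
        integralInvariant_iff.mp (hΓ _ (hGΓ _ (hmem i))) _ (hcont i) (hcomp i) (hsupp i)
    _ = ∫ x, ∑ i, χ i x * ζ x ∂μ := (integral_finsetSum _ fun i _ =>
        (hcont i).integrable_of_hasCompactSupport (hcomp i)).symm
    _ = ∫ x, ζ x ∂μ := integral_congr_ae (Eventually.of_forall fun x => (hsum x).symm)

end Invariance

/-- An equicontinuous pseudo*group with dense orbits has a nonzero invariant measure. -/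
theorem exists_regular_integralInvariant {X : Type*} [MetricSpace X] [LocallyCompactSpace X]
    [Nonempty X] [MeasurableSpace X] [BorelSpace X] {Γ : Set (OpenPartialHomeomorph X X)}
    (hΓ : IsPseudoStarGroup Γ)
    (heq : ∀ ε > 0, ∃ δ > 0, ∀ γ ∈ Γ, ∀ x ∈ γ.source, ∀ x' ∈ γ.source,
      dist x x' < δ → dist (γ x) (γ x') ≤ ε)
    (hmin : ∀ (x : X) (U : Set X), IsOpen U → U.Nonempty → ∃ γ ∈ Γ, x ∈ γ.source ∧ γ x ∈ U) :
    ∃ μ : Measure X, μ.Regular ∧ μ ≠ 0 ∧ ∀ γ ∈ Γ, IntegralInvariant μ γ := by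
  obtain ⟨Λ, hΛ, hinv⟩ := exists_invariant_functional hΓ heq hmin
  refine ⟨NNRealRMK.rieszMeasure Λ, inferInstance, ?_, fun γ hγ => ?_⟩
  · intro h
    refine hΛ (LinearMap.ext fun f => ?_)
    have := NNRealRMK.integral_rieszMeasure Λ f
    rw [h, integral_zero_measure] at this
    exact_mod_cast this.symm
  · refine integralInvariant_of_nnreal fun f g hf hg => ?_
    rw [NNRealRMK.integral_rieszMeasure, NNRealRMK.integral_rieszMeasure, hinv γ hγ f g hf hg]

/-! ### Open sets under an invariant measure -/

section InvariantMeasure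

variable {X : Type*} [TopologicalSpace X] [T2Space X] [LocallyCompactSpace X] [MeasurableSpace X]
  [BorelSpace X] {μ : Measure X} [μ.Regular]

/-- An invariant regular measure does not decrease open sets. -/
theorem IntegralInvariant.measure_le_image {γ : OpenPartialHomeomorph X X}
    (h : IntegralInvariant μ γ) {A : Set X} (hA : IsOpen A) (hAs : A ⊆ γ.source) :
    μ A ≤ μ (γ '' A) := by
  rw [hA.measure_eq_iSup_isCompact]
  refine iSup₂_le fun K hKA => iSup_le fun hK => ?_
  -- A function between the indicators of `K` and `A` is transported to one below the indicator of
  -- `γ '' A`, with the same integral.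
  obtain ⟨f, hfA, hf1, hfle⟩ := exists_bump hK hA hKA
  have hcont : Continuous fun x => (f x : ℝ) := by fun_prop
  have hcomp : HasCompactSupport fun x => (f x : ℝ) :=
    f.hasCompactSupport.comp_left (g := fun r : ℝ≥0 => (r : ℝ)) rfl
  have hts : tsupport (fun x => (f x : ℝ)) ⊆ A :=
    (closure_mono (Function.support_comp_subset (g := fun r : ℝ≥0 => (r : ℝ)) rfl f)).trans hfA
  have hinv := integralInvariant_iff.mp h _ hcont hcomp (hts.trans hAs)
  have hpc := continuous_push γ hcont hcomp (hts.trans hAs)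
  have hps := hasCompactSupport_push γ hcomp (hts.trans hAs)
  have hpint := hpc.integrable_of_hasCompactSupport hps (μ := μ)
  have hint := hcont.integrable_of_hasCompactSupport hcomp (μ := μ)
  have hpnonneg : ∀ y, 0 ≤ γ.push (fun x => (f x : ℝ)) y := fun y =>
    indicator_nonneg (fun _ _ => NNReal.coe_nonneg _) y
  have hAo : IsOpen (γ '' A) := γ.isOpen_image_of_subset_source hA hAs
  calc μ K = ∫⁻ x in K, 1 ∂μ := by simp
    _ ≤ ∫⁻ x in K, f x ∂μ := setLIntegral_mono' hK.measurableSet fun x hx => by simp [hf1 x hx]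
    _ ≤ ∫⁻ x, f x ∂μ := setLIntegral_le_lintegral _ _
    _ = ∫⁻ x, ENNReal.ofReal (f x : ℝ) ∂μ := by simp
    _ = ENNReal.ofReal (∫ x, (f x : ℝ) ∂μ) :=
      (ofReal_integral_eq_lintegral_ofReal hint
        (Eventually.of_forall fun x => NNReal.coe_nonneg _)).symm
    _ = ENNReal.ofReal (∫ y, γ.push (fun x => (f x : ℝ)) y ∂μ) := by rw [hinv]
    _ = ∫⁻ y, ENNReal.ofReal (γ.push (fun x => (f x : ℝ)) y) ∂μ :=
      ofReal_integral_eq_lintegral_ofReal hpint (Eventually.of_forall hpnonneg)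
    _ ≤ ∫⁻ y, (γ '' A).indicator 1 y ∂μ := by
      refine lintegral_mono fun y => ?_
      by_cases hy : γ.push (fun x => (f x : ℝ)) y = 0
      · simp [hy]
      · obtain ⟨x, ⟨hx, hxs⟩, rfl⟩ := support_push_subset _ _ hy
        rw [indicator_of_mem (mem_image_of_mem _ (hts (subset_tsupport _ hx))),
          push_apply_map _ _ hxs]
        simpa using hfle x
    _ = μ (γ '' A) := by rw [lintegral_indicator hAo.measurableSet]; simp

/-- An invariant measure of a pseudo*group with dense orbits has full support. -/
theorem measure_pos_of_isOpen [SecondCountableTopology X] {Γ : Set (OpenPartialHomeomorph X X)}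
    (hμΓ : ∀ γ ∈ Γ, IntegralInvariant μ γ)
    (hmin : ∀ (x : X) (U : Set X), IsOpen U → U.Nonempty → ∃ γ ∈ Γ, x ∈ γ.source ∧ γ x ∈ U)
    (hμ : μ ≠ 0) {U : Set X} (hU : IsOpen U) (hne : U.Nonempty) : 0 < μ U := by
  rw [pos_iff_ne_zero]
  intro h0
  refine hμ (Measure.measure_univ_eq_zero.mp ?_)
  -- If `U` were null, every point would have a null neighbourhood, namely one carried into `U` by a
  -- map of `Γ`.
  refine measure_null_of_locally_null _ fun x _ => ?_
  obtain ⟨γ, hγ, hx, hxU⟩ := hmin x U hU hne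
  have ho := γ.isOpen_inter_preimage hU
  refine ⟨γ.source ∩ γ ⁻¹' U, mem_nhdsWithin_of_mem_nhds (ho.mem_nhds ⟨hx, hxU⟩), ?_⟩
  have h1 := (hμΓ γ hγ).measure_le_image ho inter_subset_left
  have h2 : γ '' (γ.source ∩ γ ⁻¹' U) ⊆ U := by
    rintro _ ⟨y, hy, rfl⟩
    exact hy.2
  exact le_antisymm (h1.trans ((measure_mono h2).trans h0.le)) zero_le

end InvariantMeasure

/-! ### Invariant entourages -/

section Entourage

variable {X : Type*} [MetricSpace X] {Γ : Set (OpenPartialHomeomorph X X)}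

/-- The `Γ`-invariant entourage generated by the pairs of points at distance less than `r`. -/
def invariantEntourage (Γ : Set (OpenPartialHomeomorph X X)) (r : ℝ) : Set (X × X) :=
  {q | ∃ γ ∈ Γ, ∃ x ∈ γ.source, ∃ y ∈ γ.source, dist x y < r ∧ q = (γ x, γ y)}

theorem isOpen_invariantEntourage (Γ : Set (OpenPartialHomeomorph X X)) (r : ℝ) :
    IsOpen (invariantEntourage Γ r) := by
  rw [isOpen_iff_mem_nhds]
  rintro q ⟨γ, hγ, x, hx, y, hy, hd, rfl⟩
  have h1 : ContinuousAt (fun q : X × X => dist (γ.symm q.1) (γ.symm q.2)) (γ x, γ y) := by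
    refine Filter.Tendsto.dist ?_ ?_
    · exact ContinuousAt.comp (f := Prod.fst) (g := γ.symm)
        (γ.continuousAt_symm (γ.map_source hx)) continuousAt_fst
    · exact ContinuousAt.comp (f := Prod.snd) (g := γ.symm)
        (γ.continuousAt_symm (γ.map_source hy)) continuousAt_snd
  have h2 := h1.eventually_lt continuousAt_const
    (show dist (γ.symm (γ x)) (γ.symm (γ y)) < r by rwa [γ.left_inv hx, γ.left_inv hy])
  filter_upwards [h2, (γ.open_target.prod γ.open_target).mem_nhds
    ⟨γ.map_source hx, γ.map_source hy⟩] with q hq hqt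
  exact ⟨γ, hγ, _, γ.map_target hqt.1, _, γ.map_target hqt.2, hq,
    by rw [γ.right_inv hqt.1, γ.right_inv hqt.2]⟩

theorem invariantEntourage_symm {r : ℝ} {x y : X} (h : (x, y) ∈ invariantEntourage Γ r) :
    (y, x) ∈ invariantEntourage Γ r := by
  obtain ⟨γ, hγ, a, ha, b, hb, hd, he⟩ := h
  obtain ⟨rfl, rfl⟩ := Prod.mk.inj he
  exact ⟨γ, hγ, b, hb, a, ha, by rwa [dist_comm], rfl⟩

theorem mem_invariantEntourage_self (hΓ : IsPseudoStarGroup Γ) {r : ℝ} (hr : 0 < r) (x : X) :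
    (x, x) ∈ invariantEntourage Γ r :=
  ⟨_, hΓ.refl_mem, x, mem_univ _, x, mem_univ _, by simpa, rfl⟩

theorem map_mem_invariantEntourage (hΓ : IsPseudoStarGroup Γ) {r : ℝ} {x y : X}
    (h : (x, y) ∈ invariantEntourage Γ r) {γ : OpenPartialHomeomorph X X} (hγ : γ ∈ Γ)
    (hx : x ∈ γ.source) (hy : y ∈ γ.source) : (γ x, γ y) ∈ invariantEntourage Γ r := by
  obtain ⟨γ', hγ', a, ha, b, hb, hd, he⟩ := h
  obtain ⟨rfl, rfl⟩ := Prod.mk.inj he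
  exact ⟨_, hΓ.trans_mem' hγ' hγ, a, by simp [ha, hx], b, by simp [hb, hy], hd, rfl⟩

/-- This is equicontinuity restated: images of close pairs are close, uniformly over `Γ`. -/
theorem exists_invariantEntourage_subset
    (heq : ∀ ε > 0, ∃ δ > 0, ∀ γ ∈ Γ, ∀ x ∈ γ.source, ∀ x' ∈ γ.source,
      dist x x' < δ → dist (γ x) (γ x') ≤ ε) {ε : ℝ} (hε : 0 < ε) :
    ∃ δ > 0, ∀ r ≤ δ, ∀ x y, (x, y) ∈ invariantEntourage Γ r → dist x y < ε := by
  obtain ⟨δ, hδ, h⟩ := heq (ε / 2) (by positivity)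
  refine ⟨δ, hδ, fun r hr x y hxy => ?_⟩
  obtain ⟨γ, hγ, a, ha, b, hb, hd, he⟩ := hxy
  obtain ⟨rfl, rfl⟩ := Prod.mk.inj he
  linarith [h γ hγ a ha b hb (hd.trans_le hr)]

end Entourage

/-! ### Comparison of measures through the size of fibres -/

section Comparison

/-- Christensen's argument for uniformly distributed measures. -/
theorem measure_le_liminf_mul {X : Type*} [TopologicalSpace X] [SecondCountableTopology X]
    [MeasurableSpace X] [BorelSpace X] {μ ν : Measure X} [SFinite μ] [SFinite ν]
    {E : ℕ → Set (X × X)} (hE : ∀ n, IsOpen (E n)) (hsymm : ∀ n x y, (x, y) ∈ E n → (y, x) ∈ E n)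
    {V : Set X} (hV : IsOpen V) (hsmall : ∀ x ∈ V, ∀ᶠ n in atTop, Prod.mk x ⁻¹' E n ⊆ V)
    {k g : ℕ → ℝ≥0∞} (hν : ∀ᶠ n in atTop, ∀ x ∈ V, ν (Prod.mk x ⁻¹' E n) = k n)
    (hμ : ∀ᶠ n in atTop, ∀ x ∈ V, μ (Prod.mk x ⁻¹' E n) = g n)
    (hk0 : ∀ᶠ n in atTop, k n ≠ 0) (hk : ∀ᶠ n in atTop, k n ≠ ∞) (hνV : ν V ≠ ∞) :
    μ V ≤ liminf (fun n => g n / k n) atTop * ν V := by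
  have hmeas : ∀ n, Measurable fun x => ν (V ∩ Prod.mk x ⁻¹' E n) := fun n => by
    have h := measurable_measure_prodMk_left (ν := ν)
      ((hE n).inter (isOpen_univ.prod hV)).measurableSet
    convert h using 3 with x
    ext y; simp [and_comm]
  -- For large `n` the fibre over `x` lies in `V`, so the quotient is eventually `1`. How large
  -- depends on `x`, and Fatou's lemma is what allows integrating this over `V`.
  have hpt : ∀ x ∈ V, 1 ≤ liminf (fun n => ν (V ∩ Prod.mk x ⁻¹' E n) / k n) atTop := by
    intro x hx
    refine le_liminf_of_le (by isBoundedDefault) ?_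
    filter_upwards [hsmall x hx, hν, hk0, hk] with n h1 h2 h3 h4
    rw [inter_eq_self_of_subset_right h1, h2 x hx, ENNReal.div_self h3 h4]
  -- Both sides are the product measure of `(V ×ˢ V) ∩ E n`; symmetry of `E n` identifies its two
  -- families of fibres.
  have hswap : ∀ n, ∫⁻ x in V, ν (V ∩ Prod.mk x ⁻¹' E n) ∂μ =
      ∫⁻ y in V, μ (V ∩ Prod.mk y ⁻¹' E n) ∂ν := by
    intro n
    have hS : MeasurableSet ((V ×ˢ V) ∩ E n) := ((hV.prod hV).inter (hE n)).measurableSet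
    have h1 := Measure.prod_apply (μ := μ) (ν := ν) hS
    have h2 := Measure.prod_apply_symm (μ := μ) (ν := ν) hS
    rw [← lintegral_indicator hV.measurableSet, ← lintegral_indicator hV.measurableSet]
    refine Eq.trans ?_ ((h1.symm.trans h2).trans ?_)
    · refine lintegral_congr fun x => ?_
      by_cases hx : x ∈ V
      · rw [indicator_of_mem hx]
        congr 1
        ext y; simp [hx]
      · rw [indicator_of_notMem hx]
        symm
        convert measure_empty (μ := ν)
        ext y; simp [hx]
    · refine lintegral_congr fun y => ?_
      by_cases hy : y ∈ V
      · rw [indicator_of_mem hy]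
        congr 1
        ext x
        simp only [mem_preimage, mem_inter_iff, mem_prod, hy, and_true]
        exact and_congr_right fun _ => ⟨hsymm n x y, hsymm n y x⟩
      · rw [indicator_of_notMem hy]
        convert measure_empty (μ := μ)
        ext x; simp [hy]
  calc μ V = ∫⁻ x in V, 1 ∂μ := by simp
    _ ≤ ∫⁻ x in V, liminf (fun n => ν (V ∩ Prod.mk x ⁻¹' E n) / k n) atTop ∂μ :=
        setLIntegral_mono' hV.measurableSet hpt
    _ ≤ liminf (fun n => ∫⁻ x in V, ν (V ∩ Prod.mk x ⁻¹' E n) / k n ∂μ) atTop :=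
        lintegral_liminf_le fun n => (hmeas n).div_const _
    _ ≤ liminf (fun n => g n / k n * ν V) atTop := by
        refine liminf_le_liminf ?_
        filter_upwards [hμ] with n h1
        simp_rw [ENNReal.div_eq_inv_mul]
        rw [lintegral_const_mul _ (hmeas n), hswap, mul_assoc]
        gcongr
        calc ∫⁻ y in V, μ (V ∩ Prod.mk y ⁻¹' E n) ∂ν ≤ ∫⁻ y in V, g n ∂ν :=
              setLIntegral_mono' hV.measurableSet fun y hy =>
                (measure_mono inter_subset_right).trans (h1 y hy).le
          _ = g n * ν V := by simp
    _ = liminf (fun n => g n / k n) atTop * ν V := by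
        rw [ENNReal.liminf_mul_const_of_ne_top hνV, mul_comm]

/-- By inner regularity `μ U` is a supremum over compact subsets, and a relatively compact open set
fits between each of them and `U`. -/
theorem measure_le_of_relativelyCompact {X : Type*} [TopologicalSpace X] [R1Space X]
    [LocallyCompactSpace X] [MeasurableSpace X] {μ ν : Measure X} [μ.Regular]
    (h : ∀ V, IsOpen V → IsCompact (closure V) → μ V ≤ ν V) {U : Set X} (hU : IsOpen U) :
    μ U ≤ ν U := by
  rw [hU.measure_eq_iSup_isCompact]
  refine iSup₂_le fun K hKU => iSup_le fun hK => ?_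
  obtain ⟨V, hV, hKV, hVU, hVc⟩ := exists_open_between_and_isCompact_closure hK hU hKU
  exact (measure_mono hKV).trans ((h V hV hVc).trans (measure_mono (subset_closure.trans hVU)))

end Comparison

/-! ### Uniqueness from maps with uniform domains -/

section Uniqueness

variable {X : Type*} [MetricSpace X] [LocallyCompactSpace X] [MeasurableSpace X]
  [BorelSpace X] {Γ : Set (OpenPartialHomeomorph X X)}

/-- Between any two points of an open set `V` there are, up to a small change of the first point,
maps of `Γ` defined on a ball of radius `δ`. -/
def HasUniformDomains (Γ : Set (OpenPartialHomeomorph X X)) (V : Set X) (δ : ℝ) : Prop :=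
  ∀ x ∈ V, ∀ y ∈ V, ∀ W : Set X, IsOpen W → y ∈ W →
    ∃ γ ∈ Γ, ∃ y' ∈ W, Metric.ball y' δ ⊆ γ.source ∧ y' ∈ γ.source ∧ γ y' = x

/-- The fibre over `y'` lies in the ball of radius `δ`, hence in the domain of a map of `Γ` taking
`y'` to `x`. By invariance of the entourage this map sends it into the fibre over `x`, and it does
not decrease the measure. Such maps start only near `y`, so `y` is approximated by `y'`. -/
theorem measure_fiber_le (hΓ : IsPseudoStarGroup Γ) {μ : Measure X} [μ.Regular]
    (hμ : ∀ γ ∈ Γ, IntegralInvariant μ γ) {V : Set X} {δ r : ℝ} (hV : HasUniformDomains Γ V δ)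
    (hr : ∀ x y, (x, y) ∈ invariantEntourage Γ r → dist x y < δ) {x y : X} (hx : x ∈ V)
    (hy : y ∈ V) :
    μ (Prod.mk y ⁻¹' invariantEntourage Γ r) ≤ μ (Prod.mk x ⁻¹' invariantEntourage Γ r) := by
  have hopen : ∀ z : X, IsOpen (Prod.mk z ⁻¹' invariantEntourage Γ r) := fun z =>
    (isOpen_invariantEntourage Γ r).preimage (by fun_prop)
  rw [(hopen y).measure_eq_iSup_isCompact]
  refine iSup₂_le fun K hK => iSup_le fun hKc => ?_
  -- Openness of the entourage and compactness of `K` put `K` in the fibre over every `y'` close to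
  -- `y`.
  obtain ⟨W, W', hW, hW', hyW, hKW', hWW'⟩ := generalized_tube_lemma (isCompact_singleton (x := y))
    hKc (isOpen_invariantEntourage Γ r) (by
      rintro ⟨a, b⟩ ⟨ha, hb⟩
      obtain rfl : a = y := ha
      exact hK hb)
  obtain ⟨γ, hγ, y', hy', hball, hys, rfl⟩ := hV x hx y hy W hW (hyW rfl)
  have hsub : Prod.mk y' ⁻¹' invariantEntourage Γ r ⊆ γ.source := fun z hz =>
    hball (by rw [Metric.mem_ball, dist_comm]; exact hr _ _ hz)
  calc μ K ≤ μ (Prod.mk y' ⁻¹' invariantEntourage Γ r) :=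
        measure_mono fun z hz => hWW' ⟨hy', hKW' hz⟩
    _ ≤ μ (γ '' (Prod.mk y' ⁻¹' invariantEntourage Γ r)) :=
        (hμ γ hγ).measure_le_image (hopen y') hsub
    _ ≤ _ := measure_mono (by
        rintro _ ⟨z, hz, rfl⟩
        exact map_mem_invariantEntourage hΓ hz hγ hys (hsub hz))

theorem measure_fiber_eq (hΓ : IsPseudoStarGroup Γ) {μ : Measure X} [μ.Regular]
    (hμ : ∀ γ ∈ Γ, IntegralInvariant μ γ) {V : Set X} {δ r : ℝ} (hV : HasUniformDomains Γ V δ)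
    (hr : ∀ x y, (x, y) ∈ invariantEntourage Γ r → dist x y < δ) {x y : X} (hx : x ∈ V)
    (hy : y ∈ V) :
    μ (Prod.mk y ⁻¹' invariantEntourage Γ r) = μ (Prod.mk x ⁻¹' invariantEntourage Γ r) :=
  le_antisymm (measure_fiber_le hΓ hμ hV hr hx hy) (measure_fiber_le hΓ hμ hV hr hy hx)

/-- Two invariant measures are proportional on relatively compact open sets. -/
theorem exists_measure_eq_mul [SecondCountableTopology X] (hΓ : IsPseudoStarGroup Γ)
    (heq : ∀ ε > 0, ∃ δ > 0, ∀ γ ∈ Γ, ∀ x ∈ γ.source, ∀ x' ∈ γ.source,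
      dist x x' < δ → dist (γ x) (γ x') ≤ ε)
    (hmin : ∀ (x : X) (U : Set X), IsOpen U → U.Nonempty → ∃ γ ∈ Γ, x ∈ γ.source ∧ γ x ∈ U)
    {μ ν : Measure X} [μ.Regular] [ν.Regular] (hμ : ∀ γ ∈ Γ, IntegralInvariant μ γ)
    (hν : ∀ γ ∈ Γ, IntegralInvariant ν γ) (hμ0 : μ ≠ 0) (hν0 : ν ≠ 0)
    {V : Set X} (hV : IsOpen V) (hVc : IsCompact (closure V)) (hne : V.Nonempty) {δ : ℝ}
    (hδ : 0 < δ) (hdom : HasUniformDomains Γ V δ) :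
    ∃ a : ℝ≥0∞, a ≠ 0 ∧ a ≠ ∞ ∧ ∀ V' ⊆ V, IsOpen V' → μ V' = a * ν V' := by
  obtain ⟨x₀, hx₀⟩ := hne
  set E : ℕ → Set (X × X) := fun n => invariantEntourage Γ (1 / ((n : ℝ) + 1)) with hE
  have hEo : ∀ n, IsOpen (E n) := fun n => isOpen_invariantEntourage Γ _
  have hEs : ∀ n x y, (x, y) ∈ E n → (y, x) ∈ E n := fun n x y => invariantEntourage_symm
  have hEε : ∀ ε : ℝ, 0 < ε → ∀ᶠ n in atTop, ∀ x y, (x, y) ∈ E n → dist x y < ε := by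
    intro ε hε
    obtain ⟨δ', hδ', h⟩ := exists_invariantEntourage_subset heq hε
    filter_upwards [tendsto_one_div_add_atTop_nhds_zero_nat.eventually (gt_mem_nhds hδ')] with n hn
    exact h _ hn.le
  have hsmall : ∀ V' : Set X, IsOpen V' → ∀ x ∈ V', ∀ᶠ n in atTop, Prod.mk x ⁻¹' E n ⊆ V' := by
    intro V' hV' x hx
    obtain ⟨ε, hε, hball⟩ := Metric.isOpen_iff.mp hV' x hx
    filter_upwards [hEε ε hε] with n hn y hy
    exact hball (by rw [Metric.mem_ball, dist_comm]; exact hn x y hy)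
  have hfin : ∀ (ρ : Measure X) [ρ.Regular], ρ V ≠ ∞ := fun ρ _ =>
    ((measure_mono subset_closure).trans_lt hVc.measure_lt_top).ne
  have hconst : ∀ (ρ : Measure X) [ρ.Regular], (∀ γ ∈ Γ, IntegralInvariant ρ γ) → ρ ≠ 0 →
      (∀ᶠ n in atTop, ∀ x ∈ V, ρ (Prod.mk x ⁻¹' E n) = ρ (Prod.mk x₀ ⁻¹' E n)) ∧
      (∀ᶠ n in atTop, ρ (Prod.mk x₀ ⁻¹' E n) ≠ 0) ∧
      ∀ᶠ n in atTop, ρ (Prod.mk x₀ ⁻¹' E n) ≠ ∞ := by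
    intro ρ _ hρ hρ0
    refine ⟨?_, Eventually.of_forall fun n => ?_, ?_⟩
    · filter_upwards [hEε δ hδ] with n hn x hx
      exact measure_fiber_eq hΓ hρ hdom hn hx₀ hx
    · exact (measure_pos_of_isOpen hρ hmin hρ0 ((hEo n).preimage (by fun_prop))
        ⟨x₀, mem_invariantEntourage_self hΓ (by positivity) x₀⟩).ne'
    · filter_upwards [hsmall V hV x₀ hx₀] with n hn
      exact ((measure_mono hn).trans_lt (hfin ρ).lt_top).ne
  set k : ℕ → ℝ≥0∞ := fun n => ν (Prod.mk x₀ ⁻¹' E n)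
  set g : ℕ → ℝ≥0∞ := fun n => μ (Prod.mk x₀ ⁻¹' E n)
  obtain ⟨hμ1, hμ2, hμ3⟩ := hconst μ hμ hμ0
  obtain ⟨hν1, hν2, hν3⟩ := hconst ν hν hν0
  have hle1 : ∀ V' ⊆ V, IsOpen V' → μ V' ≤ liminf (fun n => g n / k n) atTop * ν V' :=
    fun V' hsub hV' => measure_le_liminf_mul hEo hEs hV' (hsmall V' hV')
      (hν1.mono fun n h x hx => h x (hsub hx)) (hμ1.mono fun n h x hx => h x (hsub hx)) hν2 hν3
      ((measure_mono hsub).trans_lt (hfin ν).lt_top).ne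
  -- With the roles exchanged the constant is the inverse of the limsup of `g n / k n`, which is at
  -- most the inverse of its liminf. So no convergence of the ratios is needed.
  have hle2 : ∀ V' ⊆ V, IsOpen V' → ν V' ≤ (liminf (fun n => g n / k n) atTop)⁻¹ * μ V' := by
    intro V' hsub hV'
    have h1 := measure_le_liminf_mul hEo hEs hV' (hsmall V' hV')
      (hμ1.mono fun n h x hx => h x (hsub hx)) (hν1.mono fun n h x hx => h x (hsub hx)) hμ2 hμ3
      ((measure_mono hsub).trans_lt (hfin μ).lt_top).ne
    refine h1.trans (mul_le_mul_left ?_ _)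
    have h2 : liminf (fun n => k n / g n) atTop = liminf (fun n => (g n / k n)⁻¹) atTop := by
      refine liminf_congr ?_
      filter_upwards [hμ3, hμ2] with n a b
      rw [ENNReal.inv_div (Or.inr a) (Or.inr b)]
    rw [h2, ← ENNReal.inv_limsup]
    exact ENNReal.inv_le_inv.mpr liminf_le_limsup
  set a := liminf (fun n => g n / k n) atTop
  have hμV := measure_pos_of_isOpen hμ hmin hμ0 hV ⟨x₀, hx₀⟩
  have hνV := measure_pos_of_isOpen hν hmin hν0 hV ⟨x₀, hx₀⟩
  have ha0 : a ≠ 0 := fun h => by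
    have := hle1 V subset_rfl hV
    rw [h, zero_mul] at this
    exact hμV.not_ge this
  have ha : a ≠ ∞ := fun h => by
    have := hle2 V subset_rfl hV
    rw [h, ENNReal.inv_top, zero_mul] at this
    exact hνV.not_ge this
  refine ⟨a, ha0, ha, fun V' hsub hV' => le_antisymm (hle1 V' hsub hV') ?_⟩
  calc a * ν V' ≤ a * (a⁻¹ * μ V') := mul_le_mul_right (hle2 V' hsub hV') a
    _ = μ V' := by rw [← mul_assoc, ENNReal.mul_inv_cancel ha0 ha, one_mul]

/-- Invariant measures are unique up to scaling. -/
theorem exists_eq_smul_of_integralInvariant [SecondCountableTopology X] [Nonempty X]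
    (hΓ : IsPseudoStarGroup Γ)
    (heq : ∀ ε > 0, ∃ δ > 0, ∀ γ ∈ Γ, ∀ x ∈ γ.source, ∀ x' ∈ γ.source,
      dist x x' < δ → dist (γ x) (γ x') ≤ ε)
    (hmin : ∀ (x : X) (U : Set X), IsOpen U → U.Nonempty → ∃ γ ∈ Γ, x ∈ γ.source ∧ γ x ∈ U)
    (hdom : ∀ V : Set X, IsOpen V → IsCompact (closure V) → ∃ δ > 0, HasUniformDomains Γ V δ)
    {μ ν : Measure X} [μ.Regular] [ν.Regular] (hμ : ∀ γ ∈ Γ, IntegralInvariant μ γ)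
    (hν : ∀ γ ∈ Γ, IntegralInvariant ν γ) (hμ0 : μ ≠ 0) : ∃ c : ℝ≥0, ν = c • μ := by
  rcases eq_or_ne ν 0 with rfl | hν0
  · exact ⟨0, by simp⟩
  obtain ⟨x₀⟩ := ‹Nonempty X›
  obtain ⟨V₀, hV₀, hx₀, -, hV₀c⟩ := exists_open_between_and_isCompact_closure
    (isCompact_singleton (x := x₀)) isOpen_univ (subset_univ _)
  have hpos := measure_pos_of_isOpen hμ hmin hμ0 hV₀ ⟨x₀, hx₀ rfl⟩
  have hfin : ∀ (ρ : Measure X) [ρ.Regular], ρ V₀ ≠ ∞ := fun ρ _ =>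
    ((measure_mono subset_closure).trans_lt hV₀c.measure_lt_top).ne
  obtain ⟨c, hc⟩ : ∃ c : ℝ≥0, (c : ℝ≥0∞) = ν V₀ / μ V₀ :=
    ⟨_, ENNReal.coe_toNNReal (ENNReal.div_ne_top (hfin ν) hpos.ne')⟩
  have key : ∀ V, IsOpen V → IsCompact (closure V) → ν V = (c • μ) V := by
    intro V hV hVc
    -- Adding the fixed set `V₀` forces the local constant to be `ν V₀ / μ V₀`, independently of
    -- `V`.
    have hcl : IsCompact (closure (V ∪ V₀)) := by
      rw [closure_union]; exact hVc.union hV₀c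
    obtain ⟨δ, hδ, hd⟩ := hdom _ (hV.union hV₀) hcl
    obtain ⟨a, -, -, h⟩ := exists_measure_eq_mul hΓ heq hmin hν hμ hν0 hμ0 (hV.union hV₀) hcl
      ⟨x₀, Or.inr (hx₀ rfl)⟩ hδ hd
    have hca : (c : ℝ≥0∞) = a := by
      rw [hc, h V₀ subset_union_right hV₀, ENNReal.mul_div_cancel_right hpos.ne' (hfin μ)]
    rw [h V subset_union_left hV, ← hca]
    rfl
  refine ⟨c, Measure.OuterRegular.ext_isOpen fun U hU => le_antisymm ?_ ?_⟩
  · exact measure_le_of_relativelyCompact (fun V hV hVc => (key V hV hVc).le) hU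
  · exact measure_le_of_relativelyCompact (fun V hV hVc => (key V hV hVc).ge) hU

end Uniqueness

/-! ### Curves in the leaves -/

section ChartInverse

variable {p : ℕ} {Z S T : Type*} [TopologicalSpace Z] [TopologicalSpace S] [TopologicalSpace T]

/-- The inverse of a chart. -/
noncomputable def chartInv [Nonempty T] (ψ : PlaqueModel p × T → Z) : Z → PlaqueModel p × T :=
  Function.invFun ψ

theorem chartInv_apply [Nonempty T] {ψ : PlaqueModel p × T → Z} (hψ : IsOpenEmbedding ψ)
    (q : PlaqueModel p × T) : chartInv ψ (ψ q) = q :=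
  Function.leftInverse_invFun hψ.injective q

theorem apply_chartInv {Z T : Type*} [Nonempty T] {ψ : PlaqueModel p × T → Z} {z : Z} (hz : z ∈ range ψ) :
    ψ (chartInv ψ z) = z :=
  Function.invFun_eq hz

theorem continuousAt_chartInv [Nonempty T] {ψ : PlaqueModel p × T → Z} (hψ : IsOpenEmbedding ψ)
    {z : Z} (hz : z ∈ range ψ) : ContinuousAt (chartInv ψ) z := by
  obtain ⟨q, rfl⟩ := hz
  rw [ContinuousAt, chartInv_apply hψ, ← hψ.map_nhds_eq, tendsto_map'_iff]
  exact tendsto_id.congr fun q => (chartInv_apply hψ q).symm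

theorem eventually_chart {ψ : PlaqueModel p × T → Z} (hψ : IsOpenEmbedding ψ)
    {v : PlaqueModel p} {t : T} {P : PlaqueModel p → T → Prop}
    (hP : ∀ᶠ q in 𝓝 (v, t), P q.1 q.2) :
    ∀ᶠ z in 𝓝 (ψ (v, t)), ∃ v' t', z = ψ (v', t') ∧ P v' t' := by
  rw [← hψ.map_nhds_eq, eventually_map]
  exact hP.mono fun q hq => ⟨q.1, q.2, rfl, hq⟩

theorem snd_eq_of_mem_plaque {ψ : PlaqueModel p × T → Z} (hψ : IsOpenEmbedding ψ)
    {v : PlaqueModel p} {t t' : T} (h : ψ (v, t) ∈ plaque ψ t') : t = t' := by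
  obtain ⟨v', hv'⟩ := h
  exact (Prod.mk.inj (hψ.injective hv')).2.symm

end ChartInverse

section Concat

/-- The concatenation of two curves. -/
noncomputable def curveConcat {Z : Type*} (c c' : I → Z) (τ : I) : Z :=
  if (τ : ℝ) ≤ 1 / 2 then c (projIcc (0 : ℝ) 1 zero_le_one (2 * τ))
  else c' (projIcc (0 : ℝ) 1 zero_le_one (2 * τ - 1))

theorem curveConcat_zero {Z : Type*} (c c' : I → Z) : curveConcat c c' 0 = c 0 := by
  simp [curveConcat]

theorem curveConcat_one {Z : Type*} (c c' : I → Z) : curveConcat c c' 1 = c' 1 := by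
  have h : ¬ (((1 : I) : ℝ) ≤ 1 / 2) := by norm_num
  rw [curveConcat, if_neg h]
  congr 1
  rw [show 2 * ((1 : I) : ℝ) - 1 = 1 by norm_num]
  exact projIcc_right (zero_le_one (α := ℝ))

theorem continuousOn_curveConcat {Y Z : Type*} [TopologicalSpace Y] [TopologicalSpace Z] {D : Set Y}
    {H H' : I × Y → Z} (hH : ContinuousOn H (univ ×ˢ D)) (hH' : ContinuousOn H' (univ ×ˢ D))
    (h : ∀ y ∈ D, H (1, y) = H' (0, y)) :
    ContinuousOn (fun q : I × Y => curveConcat (fun τ => H (τ, q.2)) (fun τ => H' (τ, q.2)) q.1)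
      (univ ×ˢ D) := by
  have hc : Continuous fun q : I × Y => projIcc (0 : ℝ) 1 zero_le_one (2 * (q.1 : ℝ)) :=
    continuous_projIcc.comp (by fun_prop)
  have hc' : Continuous fun q : I × Y => projIcc (0 : ℝ) 1 zero_le_one (2 * (q.1 : ℝ) - 1) :=
    continuous_projIcc.comp (by fun_prop)
  unfold curveConcat
  refine ContinuousOn.if ?_ ?_ ?_
  · rintro ⟨τ, y⟩ ⟨⟨-, hy⟩, hfr⟩
    have hτ : (τ : ℝ) = 1 / 2 := frontier_le_subset_eq
      (f := fun q : I × Y => (q.1 : ℝ)) (g := fun _ => 1 / 2) (by fun_prop) (by fun_prop) hfr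
    simp only [hτ]
    norm_num
    exact h y hy
  · exact (hH.comp (hc.prodMk continuous_snd).continuousOn fun q hq => ⟨mem_univ _, hq.2⟩).mono
      inter_subset_left
  · exact (hH'.comp (hc'.prodMk continuous_snd).continuousOn fun q hq => ⟨mem_univ _, hq.2⟩).mono
      inter_subset_left

end Concat

namespace Lamination

section Curves

variable {p : ℕ} {Z : Type*} [TopologicalSpace Z] {L : Lamination p Z}
  {S T X : Type*} [TopologicalSpace S] [TopologicalSpace T] [TopologicalSpace X]
  {φ : PlaqueModel p × S → Z} {ψ : PlaqueModel p × T → Z}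

theorem isChart_chart (L : Lamination p Z) (i : L.ι) : L.IsChart (L.φ i) :=
  ⟨L.isOpenEmbedding i, L.compatible i, fun j => L.compatible j i⟩

/-- Compatibility is composed through an atlas chart around the common point, so atlas charts and
`h` can be treated alike. -/
theorem IsChart.plaqueCompatible (hφ : L.IsChart φ) (hψ : L.IsChart ψ) : PlaqueCompatible φ ψ := by
  intro u s hr
  obtain ⟨i, ⟨a, b⟩, hab⟩ := L.cover (φ (u, s))
  obtain ⟨W, hW, V, hV, β, hβ⟩ := hφ.compatible_left i u s ⟨_, hab⟩
  obtain ⟨W', hW', V', hV', β', hβ'⟩ := hψ.compatible_right i a b (hab ▸ hr)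
  have h1 := eventually_chart (L.isOpenEmbedding i) (v := a) (t := b)
    (P := fun a' b' => a' ∈ W' ∧ b' ∈ V') (prod_mem_nhds hW' hV')
  rw [hab] at h1
  have h2 := hφ.isOpenEmbedding.continuous.continuousAt.eventually h1
  obtain ⟨W₁, hW₁, V₁, hV₁, h3⟩ := mem_nhds_prod_iff.mp h2
  refine ⟨W ∩ W₁, inter_mem hW hW₁, V ∩ V₁, inter_mem hV hV₁, β' ∘ β, fun u' hu' s' hs' => ?_⟩
  obtain ⟨a', b', he, ha', hb'⟩ := h3 (mk_mem_prod hu'.2 hs'.2)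
  have h4 := hβ u' hu'.1 s' hs'.1
  rw [he] at h4 ⊢
  rw [Function.comp_apply, ← snd_eq_of_mem_plaque (L.isOpenEmbedding i) h4]
  exact hβ' a' ha' b' hb'

/-- A leafwise curve locally stays in the plaque of any chart. -/
theorem IsLeafwise.eventually_mem_plaque {c : I → Z} (hc : L.IsLeafwise c) (hψ : L.IsChart ψ)
    {τ : I} {v : PlaqueModel p} {t : T} (h : ψ (v, t) = c τ) :
    ∀ᶠ τ' in 𝓝 τ, c τ' ∈ plaque ψ t := by
  obtain ⟨i, s, hs⟩ := hc.2 τ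
  obtain ⟨u, hu : L.φ i (u, s) = c τ⟩ := hs.self_of_nhds
  obtain ⟨W, hW, V, hV, β, hβ⟩ := hψ.compatible_right i u s (hu ▸ h ▸ mem_range_self _)
  have hsV := mem_of_mem_nhds hV
  have h1 := eventually_chart (L.isOpenEmbedding i) (v := u) (t := s)
    (P := fun u' _ => u' ∈ W) (continuousAt_fst.eventually hW)
  rw [hu] at h1
  have hβt : t = β s := by
    have := hβ u (mem_of_mem_nhds hW) s hsV
    rw [hu, ← h] at this
    exact snd_eq_of_mem_plaque hψ.isOpenEmbedding this
  filter_upwards [hc.1.continuousAt.eventually h1, hs] with τ' ⟨u', s', he, hu'⟩ hm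
  have : s' = s := by
    rw [he] at hm
    exact snd_eq_of_mem_plaque (L.isOpenEmbedding i) hm
  rw [he, this, hβt]
  exact hβ u' hu' s hsV

theorem IsLeafwise.of_plaque (hφ : L.IsChart φ) {u : I → PlaqueModel p} (hu : Continuous u)
    (s : S) : L.IsLeafwise fun τ => φ (u τ, s) := by
  refine ⟨hφ.isOpenEmbedding.continuous.comp (by fun_prop), fun τ => ?_⟩
  obtain ⟨i, hi⟩ := L.cover (φ (u τ, s))
  obtain ⟨W, hW, V, hV, β, hβ⟩ := hφ.compatible_left i (u τ) s hi
  exact ⟨i, β s, (hu.continuousAt.eventually hW).mono fun τ' h => hβ _ h s (mem_of_mem_nhds hV)⟩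

theorem IsLeafwise.symm {c : I → Z} (hc : L.IsLeafwise c) : L.IsLeafwise fun τ => c (σ τ) := by
  refine ⟨hc.1.comp continuous_symm, fun τ => ?_⟩
  obtain ⟨i, s, h⟩ := hc.2 (σ τ)
  exact ⟨i, s, continuous_symm.continuousAt.eventually h⟩

theorem IsLeafwise.curveConcat {c c' : I → Z} (hc : L.IsLeafwise c) (hc' : L.IsLeafwise c')
    (h : c 1 = c' 0) : L.IsLeafwise (curveConcat c c') := by
  have hl : Continuous fun τ : I => projIcc (0 : ℝ) 1 zero_le_one (2 * (τ : ℝ)) :=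
    continuous_projIcc.comp (by fun_prop)
  have hr : Continuous fun τ : I => projIcc (0 : ℝ) 1 zero_le_one (2 * (τ : ℝ) - 1) :=
    continuous_projIcc.comp (by fun_prop)
  have hhalf : ∀ τ : I, (τ : ℝ) = 1 / 2 → projIcc (0 : ℝ) 1 zero_le_one (2 * (τ : ℝ)) = 1 ∧
      projIcc (0 : ℝ) 1 zero_le_one (2 * (τ : ℝ) - 1) = 0 := by
    intro τ hτ
    rw [hτ]
    norm_num
  refine ⟨Continuous.if_le (hc.1.comp hl) (hc'.1.comp hr) (by fun_prop) (by fun_prop) ?_, ?_⟩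
  · intro τ hτ
    rw [(hhalf τ hτ).1, (hhalf τ hτ).2, h]
  · intro τ
    -- One chart at the point serves both halves; at the junction each half stays in the plaque of
    -- the common value.
    obtain ⟨i, ⟨u, s⟩, hus⟩ := L.cover (_root_.curveConcat c c' τ)
    refine ⟨i, s, ?_⟩
    have h1 : ∀ᶠ τ' : I in 𝓝 τ, (τ' : ℝ) ≤ 1 / 2 →
        c (projIcc (0 : ℝ) 1 zero_le_one (2 * (τ' : ℝ))) ∈ plaque (L.φ i) s := by
      rcases le_or_gt (τ : ℝ) (1 / 2) with hτ | hτ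
      · have he : L.φ i (u, s) = c (projIcc (0 : ℝ) 1 zero_le_one (2 * (τ : ℝ))) := by
          rw [hus, _root_.curveConcat, if_pos hτ]
        exact (hl.continuousAt.eventually (hc.eventually_mem_plaque (L.isChart_chart i) he)).mono
          fun _ h _ => h
      · exact (continuous_subtype_val.continuousAt.eventually (lt_mem_nhds hτ)).mono
          fun _ h h' => absurd h' h.not_ge
    have h2 : ∀ᶠ τ' : I in 𝓝 τ, ¬ (τ' : ℝ) ≤ 1 / 2 →
        c' (projIcc (0 : ℝ) 1 zero_le_one (2 * (τ' : ℝ) - 1)) ∈ plaque (L.φ i) s := by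
      rcases lt_or_ge (τ : ℝ) (1 / 2) with hτ | hτ
      · exact (continuous_subtype_val.continuousAt.eventually (gt_mem_nhds hτ)).mono
          fun _ h h' => absurd h.le h'
      · have he : L.φ i (u, s) = c' (projIcc (0 : ℝ) 1 zero_le_one (2 * (τ : ℝ) - 1)) := by
          rw [hus, _root_.curveConcat]
          split_ifs with h'
          · have := hhalf τ (le_antisymm h' hτ)
            rw [this.1, this.2, h]
          · rfl
        exact (hr.continuousAt.eventually (hc'.eventually_mem_plaque (L.isChart_chart i) he)).mono
          fun _ h _ => h
    filter_upwards [h1, h2] with τ' a b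
    rw [_root_.curveConcat]
    split_ifs with h'
    · exact a h'
    · exact b h'

end Curves

end Lamination

/-! ### Holonomy between charts -/

/-- Two mutually inverse maps, continuous on open sets, form a local homeomorphism. -/
def OpenPartialHomeomorph.ofLocalInverse {S T : Type*} [TopologicalSpace S] [TopologicalSpace T]
    (b : S → T) (b' : T → S) {A : Set S} {B : Set T} (hA : IsOpen A) (hB : IsOpen B)
    (hb : ContinuousOn b A) (hb' : ContinuousOn b' B) (h : ∀ x ∈ A, b' (b x) = x)
    (h' : ∀ y ∈ B, b (b' y) = y) : OpenPartialHomeomorph S T where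
  toFun := b
  invFun := b'
  source := A ∩ b ⁻¹' B
  target := B ∩ b' ⁻¹' A
  map_source' x hx := ⟨hx.2, by rw [mem_preimage, h x hx.1]; exact hx.1⟩
  map_target' y hy := ⟨hy.2, by rw [mem_preimage, h' y hy.1]; exact hy.1⟩
  left_inv' x hx := h x hx.1
  right_inv' y hy := h' y hy.1
  open_source := hb.isOpen_inter_preimage hA hB
  open_target := hb'.isOpen_inter_preimage hB hA
  continuousOn_toFun := hb.mono inter_subset_left
  continuousOn_invFun := hb'.mono inter_subset_left

namespace Lamination

section Holonomy

variable {p : ℕ} {Z : Type*} [TopologicalSpace Z] {L : Lamination p Z}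
  {R S T X : Type*} [TopologicalSpace R] [TopologicalSpace S] [TopologicalSpace T]
  [TopologicalSpace X]
  {φ : PlaqueModel p × S → Z} {ψ : PlaqueModel p × T → Z} {χ : PlaqueModel p × R → Z}
  {u : PlaqueModel p} {v : PlaqueModel p} {w : PlaqueModel p}

/-- There is a continuous family of leafwise curves from `φ (u, s)` to `ψ (v, θ s)`, for `s` in the
domain of `θ`. -/
def IsHolonomyBetween (L : Lamination p Z) (φ : PlaqueModel p × S → Z) (u : PlaqueModel p)
    (ψ : PlaqueModel p × T → Z) (v : PlaqueModel p) (θ : OpenPartialHomeomorph S T) : Prop :=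
  ∃ H : I × S → Z, ContinuousOn H (univ ×ˢ θ.source) ∧ ∀ s ∈ θ.source,
    L.IsLeafwise (fun τ => H (τ, s)) ∧ H (0, s) = φ (u, s) ∧ H (1, s) = ψ (v, θ s)

theorem IsHolonomyBetween.trans {θ : OpenPartialHomeomorph S T} {θ' : OpenPartialHomeomorph T R}
    (h : L.IsHolonomyBetween φ u ψ v θ) (h' : L.IsHolonomyBetween ψ v χ w θ') :
    L.IsHolonomyBetween φ u χ w (θ.trans θ') := by
  obtain ⟨H, hH, h1⟩ := h
  obtain ⟨H', hH', h2⟩ := h'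
  have hs : ∀ s ∈ (θ.trans θ').source, s ∈ θ.source ∧ θ s ∈ θ'.source := fun s hs => by
    simpa using hs
  have hc : ContinuousOn (fun q : I × S => H' (q.1, θ q.2)) (univ ×ˢ (θ.trans θ').source) := by
    refine hH'.comp (continuousOn_fst.prodMk (θ.continuousOn.comp continuousOn_snd ?_)) ?_
    · exact fun q hq => (hs _ hq.2).1
    · exact fun q hq => ⟨mem_univ _, (hs _ hq.2).2⟩
  have hj : ∀ s ∈ (θ.trans θ').source, H (1, s) = H' (0, θ s) := fun s hs' => by
    rw [(h1 s (hs s hs').1).2.2, (h2 _ (hs s hs').2).2.1]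
  refine ⟨fun q => curveConcat (fun τ => H (τ, q.2)) (fun τ => H' (τ, θ q.2)) q.1,
    continuousOn_curveConcat (H' := fun q => H' (q.1, θ q.2))
      (hH.mono (prod_mono subset_rfl fun s hs' => (hs s hs').1)) hc hj, fun s hs' => ⟨?_, ?_, ?_⟩⟩
  · exact (h1 s (hs s hs').1).1.curveConcat (h2 _ (hs s hs').2).1 (hj s hs')
  · exact (curveConcat_zero _ _).trans (h1 s (hs s hs').1).2.1
  · exact (curveConcat_one _ _).trans (h2 _ (hs s hs').2).2.2

theorem IsHolonomyBetween.symm {θ : OpenPartialHomeomorph S T}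
    (h : L.IsHolonomyBetween φ u ψ v θ) : L.IsHolonomyBetween ψ v φ u θ.symm := by
  obtain ⟨H, hH, h1⟩ := h
  refine ⟨fun q => H (σ q.1, θ.symm q.2), ?_, fun t ht => ?_⟩
  · refine hH.comp ((continuous_symm.comp_continuousOn continuousOn_fst).prodMk
      (θ.continuousOn_symm.comp continuousOn_snd ?_)) ?_
    · exact fun q hq => hq.2
    · exact fun q hq => ⟨mem_univ _, θ.map_target hq.2⟩
  · have ht' := h1 _ (θ.map_target ht)
    refine ⟨ht'.1.symm, ?_, ?_⟩
    · simp only [symm_zero]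
      rw [ht'.2.2, θ.right_inv ht]
    · simp only [symm_one]
      exact ht'.2.1

/-- Sliding along straight segments inside plaques changes the base point without moving the
transverse coordinate. -/
theorem isHolonomyBetween_refl (hφ : L.IsChart φ) (u v : PlaqueModel p) :
    L.IsHolonomyBetween φ u φ v (OpenPartialHomeomorph.refl S) := by
  refine ⟨fun q => φ (AffineMap.lineMap u v (q.1 : ℝ), q.2), ?_, fun s _ => ⟨?_, ?_, ?_⟩⟩
  · refine (hφ.isOpenEmbedding.continuous.comp (Continuous.prodMk ?_ continuous_snd)).continuousOn
    simp only [AffineMap.lineMap_apply]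
    fun_prop
  · refine IsLeafwise.of_plaque hφ (u := fun τ => AffineMap.lineMap u v (τ : ℝ)) ?_ s
    simp only [AffineMap.lineMap_apply]
    fun_prop
  · simp
  · simp

/-- The transverse map `β` of `PlaqueCompatible` is not assumed continuous. Near `s` it is the
transverse coordinate of `ψ⁻¹ (φ (u, s'))`, which is continuous and is inverted by the same
construction with the charts exchanged. -/
theorem exists_local_transition (hφ : L.IsChart φ) (hψ : L.IsChart ψ) [Nonempty S] [Nonempty T]
    {s : S} {t : T} (he : φ (u, s) = ψ (v, t)) :
    ∃ A : Set S, IsOpen A ∧ s ∈ A ∧ ContinuousOn (fun s' => chartInv ψ (φ (u, s'))) A ∧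
      (∀ s' ∈ A, φ (u, s') ∈ range ψ) ∧
      (∀ s' ∈ A, (chartInv φ (ψ (v, (chartInv ψ (φ (u, s'))).2))).2 = s') ∧
      ∃ W ∈ 𝓝 u, ∀ u' ∈ W, ∀ s' ∈ A, φ (u', s') ∈ plaque ψ (chartInv ψ (φ (u, s'))).2 := by
  obtain ⟨W₁, hW₁, V₁, hV₁, β, hβ⟩ := hφ.plaqueCompatible hψ u s (he ▸ mem_range_self _)
  obtain ⟨W₂, hW₂, V₂, hV₂, β', hβ'⟩ := hψ.plaqueCompatible hφ v t (he ▸ mem_range_self _)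
  have hcφ : Continuous fun s' => φ (u, s') := hφ.isOpenEmbedding.continuous.comp (by fun_prop)
  have h1 := eventually_chart hψ.isOpenEmbedding (v := v) (t := t)
    (P := fun v' t' => v' ∈ W₂ ∧ t' ∈ V₂) (prod_mem_nhds hW₂ hV₂)
  rw [← he] at h1
  have h2 := hcφ.continuousAt.eventually h1
  obtain ⟨A, hA, hAo, hsA⟩ := mem_nhds_iff.mp (inter_mem hV₁ h2)
  have hr : ∀ s' ∈ A, φ (u, s') ∈ range ψ := fun s' hs' => by
    obtain ⟨v', t', h, -⟩ := (hA hs').2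
    exact ⟨_, h.symm⟩
  refine ⟨A, hAo, hsA, fun s' hs' => ?_, hr, fun s' hs' => ?_, W₁, hW₁, fun u' hu' s' hs' => ?_⟩
  · exact (ContinuousAt.comp (f := fun s' => φ (u, s')) (g := chartInv ψ)
      (continuousAt_chartInv hψ.isOpenEmbedding (hr s' hs')) hcφ.continuousAt).continuousWithinAt
  · obtain ⟨v', t', h, hv', ht'⟩ := (hA hs').2
    have h3 := hβ' v' hv' t' ht'
    rw [← h] at h3
    have h4 := hβ' v (mem_of_mem_nhds hW₂) t' ht'
    rw [h, chartInv_apply hψ.isOpenEmbedding]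
    obtain ⟨u'', hu''⟩ := h4
    simp only at hu''
    rw [← hu'', chartInv_apply hφ.isOpenEmbedding]
    exact (snd_eq_of_mem_plaque hφ.isOpenEmbedding h3).symm
  · have h3 := hβ u (mem_of_mem_nhds hW₁) s' (hA hs').1
    obtain ⟨v'', hv''⟩ := h3
    simp only at hv''
    rw [← hv'', chartInv_apply hψ.isOpenEmbedding]
    exact hβ u' hu' s' (hA hs').1

/-- The coordinate changes of a lamination are holonomies. -/
theorem exists_isHolonomyBetween_of_eq (hφ : L.IsChart φ) (hψ : L.IsChart ψ)
    {s : S} {t : T} (he : φ (u, s) = ψ (v, t)) :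
    ∃ θ : OpenPartialHomeomorph S T, s ∈ θ.source ∧ θ s = t ∧ L.IsHolonomyBetween φ u ψ v θ ∧
      ∃ W ∈ 𝓝 u, ∀ u' ∈ W, ∀ s' ∈ θ.source, φ (u', s') ∈ plaque ψ (θ s') := by
  have : Nonempty S := ⟨s⟩
  have : Nonempty T := ⟨t⟩
  obtain ⟨A, hA, hsA, hc, hr, hi, W, hW, hWA⟩ := exists_local_transition hφ hψ he
  obtain ⟨B, hB, htB, hc', hr', hi', -⟩ := exists_local_transition hψ hφ he.symm
  set b : S → T := fun s' => (chartInv ψ (φ (u, s'))).2 with hb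
  set b' : T → S := fun t' => (chartInv φ (ψ (v, t'))).2 with hb'
  have hbs : b s = t := by
    simp only [hb]
    rw [he, chartInv_apply hψ.isOpenEmbedding]
  refine ⟨OpenPartialHomeomorph.ofLocalInverse b b' hA hB (continuous_snd.comp_continuousOn hc)
    (continuous_snd.comp_continuousOn hc') hi hi', ⟨hsA, by rwa [mem_preimage, hbs]⟩, hbs, ?_,
    W, hW, fun u' hu' s' hs' => hWA u' hu' s' hs'.1⟩
  -- In the chart `ψ`, the point `φ (u, s')` already lies in the plaque of `b s'`; a straight
  -- segment joins it to the base point `v`.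
  refine ⟨fun q => ψ (AffineMap.lineMap (chartInv ψ (φ (u, q.2))).1 v (q.1 : ℝ), b q.2), ?_,
    fun s' hs' => ⟨?_, ?_, ?_⟩⟩
  · have h1 : ContinuousOn (fun q : I × S => chartInv ψ (φ (u, q.2))) (univ ×ˢ (A ∩ b ⁻¹' B)) :=
      hc.comp continuousOn_snd fun q hq => hq.2.1
    refine hψ.isOpenEmbedding.continuous.comp_continuousOn (ContinuousOn.prodMk ?_
      (continuous_snd.comp_continuousOn h1))
    have h2 := continuous_fst.comp_continuousOn h1
    have h3 : ContinuousOn (fun q : I × S => (q.1 : ℝ)) (univ ×ˢ (A ∩ b ⁻¹' B)) := by fun_prop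
    simp only [AffineMap.lineMap_apply]
    exact (h3.smul (continuousOn_const.vsub h2)).vadd h2
  · refine IsLeafwise.of_plaque hψ
      (u := fun τ => AffineMap.lineMap (chartInv ψ (φ (u, s'))).1 v (τ : ℝ)) ?_ (b s')
    simp only [AffineMap.lineMap_apply]
    fun_prop
  · simpa [hb] using apply_chartInv (hr s' hs'.1)
  · simp only [Icc.coe_one, AffineMap.lineMap_apply_one]
    rfl

/-- The holonomy along a leafwise curve exists. -/
theorem IsLeafwise.exists_isHolonomyBetween {c : I → Z} (hc : L.IsLeafwise c) (hφ : L.IsChart φ)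
    (hψ : L.IsChart ψ) {s : S} {t : T} (h0 : φ (u, s) = c 0) (h1 : ψ (v, t) = c 1) :
    ∃ θ : OpenPartialHomeomorph S T, s ∈ θ.source ∧ θ s = t ∧ L.IsHolonomyBetween φ u ψ v θ := by
  set P : I → Prop := fun τ => ∀ (j : L.ι) (v : PlaqueModel p) (t : L.T j), L.φ j (v, t) = c τ →
    ∃ θ : OpenPartialHomeomorph S (L.T j), s ∈ θ.source ∧ θ s = t ∧
      L.IsHolonomyBetween φ u (L.φ j) v θ with hP
  -- Inside one plaque the holonomy can be prolonged in both directions, so `P` is locally constant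
  -- and passes from `0` to `1` by connectedness of the interval.
  have hloc : IsLocallyConstant P := by
    rw [IsLocallyConstant.iff_eventually_eq]
    intro τ
    obtain ⟨k, σ', hk⟩ := hc.2 τ
    have hstep : ∀ τ₁ τ₂, c τ₁ ∈ plaque (L.φ k) σ' → c τ₂ ∈ plaque (L.φ k) σ' → P τ₁ → P τ₂ := by
      rintro τ₁ τ₂ ⟨w₁, hw₁⟩ ⟨w₂, hw₂⟩ hP1 j v t hjt
      obtain ⟨θ, hs, hθ, hh⟩ := hP1 k w₁ σ' hw₁
      obtain ⟨θ', hs', hθ', hh', -⟩ := exists_isHolonomyBetween_of_eq (L.isChart_chart k)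
        (L.isChart_chart j) (hw₂.trans hjt.symm)
      refine ⟨θ.trans θ', by simp [hs, hθ, hs'], by simp [hθ, hθ'], ?_⟩
      have := (hh.trans (isHolonomyBetween_refl (L.isChart_chart k) w₁ w₂)).trans hh'
      rwa [OpenPartialHomeomorph.trans_refl] at this
    filter_upwards [hk] with τ' hτ'
    exact propext ⟨hstep _ _ hτ' hk.self_of_nhds, hstep _ _ hk.self_of_nhds hτ'⟩
  have hP0 : P 0 := fun j v t hjt => by
    obtain ⟨θ, hs, hθ, hh, -⟩ := exists_isHolonomyBetween_of_eq hφ (L.isChart_chart j)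
      (h0.trans hjt.symm)
    exact ⟨θ, hs, hθ, hh⟩
  have hP1 : P 1 := (hloc.apply_eq_of_preconnectedSpace 0 1) ▸ hP0
  obtain ⟨j, ⟨v', t'⟩, hj⟩ := L.cover (c 1)
  obtain ⟨θ, hs, hθ, hh⟩ := hP1 j v' t' hj
  obtain ⟨θ', hs', hθ', hh', -⟩ := exists_isHolonomyBetween_of_eq (L.isChart_chart j) hψ
    (hj.trans h1.symm)
  exact ⟨θ.trans θ', by simp [hs, hθ, hs'], by simp [hθ, hθ'], hh.trans hh'⟩

variable {h : PlaqueModel p × X → Z}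

theorem IsHolonomyBetween.isHolonomyMap {γ : OpenPartialHomeomorph X X}
    (hγ : L.IsHolonomyBetween h 0 h 0 γ) : L.IsHolonomyMap h γ := by
  obtain ⟨H, hH, h1⟩ := hγ
  exact fun x hx => ⟨fun τ => H (τ, x), γ.source, γ.open_source, hx, subset_rfl, H, hH,
    fun _ => rfl, h1⟩

/-- In a minimal lamination, the orbits of the holonomy maps are dense. -/
theorem IsMinimal.exists_isHolonomyMap (hL : L.IsMinimal) (hh : L.IsChart h) (x : X) {U : Set X}
    (hU : IsOpen U) (hne : U.Nonempty) :
    ∃ γ : OpenPartialHomeomorph X X, L.IsHolonomyMap h γ ∧ x ∈ γ.source ∧ γ x ∈ U := by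
  have ho : IsOpen (h '' (univ ×ˢ U)) := hh.isOpenEmbedding.isOpenMap _ (isOpen_univ.prod hU)
  obtain ⟨y₀, hy₀⟩ := hne
  obtain ⟨_, ⟨c, hc, hc0, hc1⟩, ⟨v, y⟩, ⟨-, hy⟩, rfl⟩ := (hL (h (0, x))).exists_mem_open ho
    ⟨_, mem_image_of_mem h (mk_mem_prod (mem_univ 0) hy₀)⟩
  obtain ⟨θ, hs, hθ, hθh⟩ := hc.exists_isHolonomyBetween hh hh hc0.symm hc1.symm
  have := hθh.trans (isHolonomyBetween_refl hh v 0)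
  rw [OpenPartialHomeomorph.trans_refl] at this
  refine ⟨θ, this.isHolonomyMap, hs, ?_⟩
  change y ∈ U at hy
  rwa [hθ]

end Holonomy

end Lamination

namespace Lamination

/-! ### Local projections of `Z` to the cross section -/

section Projections

variable {p : ℕ} {Z : Type*} [TopologicalSpace Z] {L : Lamination p Z}
  {X : Type*} [TopologicalSpace X] {h : PlaqueModel p × X → Z} {N N' : Set Z} {π π' : Z → X}

/-- The map `π` projects the open set `N` to the cross section of `h` along leafwise curves. -/
def IsTransverseProjection (L : Lamination p Z) (h : PlaqueModel p × X → Z) (N : Set Z)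
    (π : Z → X) : Prop :=
  ∀ z ∈ N, ∃ (i : L.ι) (u : PlaqueModel p) (s : L.T i) (θ : OpenPartialHomeomorph (L.T i) X),
    L.φ i (u, s) = z ∧ s ∈ θ.source ∧ L.IsHolonomyBetween (L.φ i) u h 0 θ ∧
      ∃ W ∈ 𝓝 u, ∀ u' ∈ W, ∀ s' ∈ θ.source, π (L.φ i (u', s')) = θ s'

theorem IsTransverseProjection.continuousAt (hπ : L.IsTransverseProjection h N π) {z : Z}
    (hz : z ∈ N) : ContinuousAt π z := by
  obtain ⟨i, u, s, θ, rfl, hs, -, W, hW, hπθ⟩ := hπ z hz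
  have : Nonempty (L.T i) := ⟨s⟩
  have h1 := eventually_chart (L.isOpenEmbedding i) (v := u) (t := s)
    (P := fun u' s' => u' ∈ W ∧ s' ∈ θ.source) (prod_mem_nhds hW (θ.open_source.mem_nhds hs))
  have h2 : ContinuousAt (fun z => θ (chartInv (L.φ i) z).2) (L.φ i (u, s)) := by
    have h3 : ContinuousAt (fun z => (chartInv (L.φ i) z).2) (L.φ i (u, s)) :=
      continuousAt_snd.comp (continuousAt_chartInv (L.isOpenEmbedding i) (mem_range_self _))
    refine ContinuousAt.comp (g := θ) (f := fun z => (chartInv (L.φ i) z).2) ?_ h3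
    simp only [chartInv_apply (L.isOpenEmbedding i)]
    exact θ.continuousAt hs
  refine h2.congr ?_
  filter_upwards [h1] with z hz
  obtain ⟨u', s', rfl, hu', hs'⟩ := hz
  rw [hπθ u' hu' s' hs', chartInv_apply (L.isOpenEmbedding i)]

/-- A leafwise curve locally keeps its transverse coordinate, and near the point the projection
depends on that coordinate alone. -/
theorem IsTransverseProjection.eventually_eq (hπ : L.IsTransverseProjection h N π) {c : I → Z}
    (hc : L.IsLeafwise c) {τ : I} (hτ : c τ ∈ N) : ∀ᶠ τ' in 𝓝 τ, π (c τ') = π (c τ) := by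
  obtain ⟨i, u, s, θ, he, hs, -, W, hW, hπθ⟩ := hπ _ hτ
  have h1 := eventually_chart (L.isOpenEmbedding i) (v := u) (t := s)
    (P := fun u' _ => u' ∈ W) (continuousAt_fst.eventually hW)
  rw [he] at h1
  filter_upwards [hc.1.continuousAt.eventually h1,
    hc.eventually_mem_plaque (L.isChart_chart i) he] with τ' ⟨u', s', he', hu'⟩ hp
  rw [he'] at hp
  rw [he', snd_eq_of_mem_plaque (L.isOpenEmbedding i) hp, hπθ u' hu' s hs, ← he,
    hπθ u (mem_of_mem_nhds hW) s hs]

/-- Two transverse projections differ by a holonomy map. -/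
theorem IsTransverseProjection.exists_isHolonomyMap (hπ : L.IsTransverseProjection h N π)
    (hπ' : L.IsTransverseProjection h N' π') {z : Z} (hz : z ∈ N) (hz' : z ∈ N') :
    ∃ γ : OpenPartialHomeomorph X X, L.IsHolonomyMap h γ ∧ π z ∈ γ.source ∧
      ∀ᶠ z' in 𝓝 z, γ (π z') = π' z' := by
  obtain ⟨i, u, s, θ, he, hs, hθ, W, hW, hπθ⟩ := hπ z hz
  obtain ⟨j, v, t, θ', he', ht, hθ', W', hW', hπθ'⟩ := hπ' z hz'
  obtain ⟨β, hβs, hβ, hβh, W'', hW'', hβp⟩ := exists_isHolonomyBetween_of_eq (L.isChart_chart i)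
    (L.isChart_chart j) (he.trans he'.symm)
  have hπz : π z = θ s := by rw [← he, hπθ u (mem_of_mem_nhds hW) s hs]
  refine ⟨θ.symm.trans (β.trans θ'), (hθ.symm.trans (hβh.trans hθ')).isHolonomyMap, ?_, ?_⟩
  · rw [hπz]
    simp [θ.map_source hs, θ.left_inv hs, hβs, hβ, ht]
  · have h1 := eventually_chart (L.isOpenEmbedding i) (v := u) (t := s)
      (P := fun u' s' => u' ∈ W ∩ W'' ∧ s' ∈ θ.source ∩ (β.source ∩ β ⁻¹' θ'.source))
      (prod_mem_nhds (inter_mem hW hW'') (inter_mem (θ.open_source.mem_nhds hs)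
        ((β.isOpen_inter_preimage θ'.open_source).mem_nhds ⟨hβs, by rwa [mem_preimage, hβ]⟩)))
    have h2 := eventually_chart (L.isOpenEmbedding j) (v := v) (t := t)
      (P := fun v' _ => v' ∈ W') (continuousAt_fst.eventually hW')
    rw [he] at h1
    rw [he'] at h2
    filter_upwards [h1, h2] with z' ⟨u', s', hz1, hu', hs'⟩ ⟨v', t', hz2, hv'⟩
    have h3 := hβp u' hu'.2 s' hs'.2.1
    rw [← hz1, hz2] at h3
    have h4 := snd_eq_of_mem_plaque (L.isOpenEmbedding j) h3
    have h5 : π z' = θ s' := by rw [hz1, hπθ u' hu'.1 s' hs'.1]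
    have h6 : π' z' = θ' (β s') := by rw [hz2, h4, hπθ' v' hv' _ hs'.2.2]
    rw [h5, h6]
    simp [θ.left_inv hs'.1]

theorem isTransverseProjection_chart [Nonempty X] (hh : L.IsChart h) :
    L.IsTransverseProjection h (range h) fun z => (chartInv h z).2 := by
  rintro _ ⟨⟨v, x⟩, rfl⟩
  obtain ⟨i, ⟨u, s⟩, hi⟩ := L.cover (h (v, x))
  obtain ⟨θ, hs, hθ, hθh, W, hW, hp⟩ := exists_isHolonomyBetween_of_eq (L.isChart_chart i) hh hi
  have h1 := hθh.trans (isHolonomyBetween_refl hh v 0)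
  rw [OpenPartialHomeomorph.trans_refl] at h1
  refine ⟨i, u, s, θ, hi, hs, h1, W, hW, fun u' hu' s' hs' => ?_⟩
  obtain ⟨v', hv' : h (v', θ s') = _⟩ := hp u' hu' s' hs'
  simp only [← hv', chartInv_apply hh.isOpenEmbedding]

/-- The leaf through `z` meets the open image of `h`; holonomy along a connecting curve carries the
transverse coordinate of a chart at `z` to `X`. -/
theorem IsMinimal.exists_isTransverseProjection [Nonempty X] (hL : L.IsMinimal) (hh : L.IsChart h)
    (z : Z) : ∃ (N : Set Z) (π : Z → X), IsOpen N ∧ z ∈ N ∧ L.IsTransverseProjection h N π := by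
  obtain ⟨_, ⟨c, hc, hc0, hc1⟩, ⟨v, x⟩, rfl⟩ := (hL z).exists_mem_open
    hh.isOpenEmbedding.isOpen_range (range_nonempty h)
  obtain ⟨i, ⟨u, s⟩, hi⟩ := L.cover z
  obtain ⟨θ, hs, hθ, hθh⟩ := hc.exists_isHolonomyBetween (L.isChart_chart i) hh
    (hi.trans hc0.symm) hc1.symm
  have : Nonempty (L.T i) := ⟨s⟩
  refine ⟨L.φ i '' (univ ×ˢ θ.source), fun z => θ (chartInv (L.φ i) z).2,
    (L.isOpenEmbedding i).isOpenMap _ (isOpen_univ.prod θ.open_source),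
    ⟨(u, s), ⟨mem_univ _, hs⟩, hi⟩, ?_⟩
  rintro _ ⟨⟨u', s'⟩, ⟨-, hs'⟩, rfl⟩
  have h1 := ((isHolonomyBetween_refl (L.isChart_chart i) u' u).trans hθh).trans
    (isHolonomyBetween_refl hh v 0)
  rw [OpenPartialHomeomorph.trans_refl, OpenPartialHomeomorph.refl_trans] at h1
  exact ⟨i, u', s', θ, rfl, hs', h1, univ, univ_mem, fun u'' _ s'' _ => by
    simp only [chartInv_apply (L.isOpenEmbedding i)]⟩

end Projections

/-! ### Holonomy maps with domains of uniform size -/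

section UniformDomains

variable {p : ℕ} {Z : Type*} [MetricSpace Z] {L : Lamination p Z}
  {X : Type*} [MetricSpace X] {h : PlaqueModel p × X → Z} {N N' : Set Z} {π π' : Z → X}
  {Γ : Set (OpenPartialHomeomorph X X)}

/-- A Lebesgue number argument: a single map of `Γ` relates the two projections near a point of `C`,
and its domain contains balls of half the radius about nearby projected points. -/
theorem eventually_exists_ball_subset_source (hΓ : L.IsHolonomyPseudoStarGroup h Γ)
    (hπ : L.IsTransverseProjection h N π) (hπ' : L.IsTransverseProjection h N' π') {C : Set Z}
    (hC : IsCompact C) (hCN : C ⊆ N) (hCN' : C ⊆ N') :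
    ∀ᶠ r in 𝓝[>] (0 : ℝ), ∀ z ∈ C, ∃ γ ∈ Γ, Metric.ball (π z) r ⊆ γ.source ∧ γ (π z) = π' z := by
  refine IsCompact.induction_on (p := fun C => ∀ᶠ r in 𝓝[>] (0 : ℝ), ∀ z ∈ C, ∃ γ ∈ Γ,
    Metric.ball (π z) r ⊆ γ.source ∧ γ (π z) = π' z) hC (by simp) ?_ ?_ ?_
  · exact fun s t hst ht => ht.mono fun r hr z hz => hr z (hst hz)
  · intro s t hs ht
    filter_upwards [hs, ht] with r h1 h2 z hz
    exact hz.elim (h1 z) (h2 z)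
  · intro z hz
    obtain ⟨γ₀, hγ₀, hz₀, hev⟩ := hπ.exists_isHolonomyMap hπ' (hCN hz) (hCN' hz)
    obtain ⟨γ, hγ, hzγ, -, he⟩ := hΓ.exists_restr γ₀ hγ₀ _ hz₀
    obtain ⟨ρ, hρ, hball⟩ := Metric.isOpen_iff.mp γ.open_source _ hzγ
    have hρ2 : 0 < ρ / 2 := by positivity
    have hnear := (hπ.continuousAt (hCN hz)).eventually (Metric.ball_mem_nhds (π z) hρ2)
    refine ⟨_, mem_nhdsWithin_of_mem_nhds (inter_mem hev hnear), ?_⟩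
    filter_upwards [Ioo_mem_nhdsGT hρ2] with r hr z' ⟨hz1, hz2⟩
    have hsub : Metric.ball (π z') r ⊆ Metric.ball (π z) ρ :=
      Metric.ball_subset_ball' (by linarith [hr.2, Metric.mem_ball.mp hz2])
    refine ⟨γ, hγ, hsub.trans hball, ?_⟩
    rw [he (hball (hsub (Metric.mem_ball_self hr.1)))]
    exact hz1

/-- In a compact minimal lamination, holonomy maps extend to balls of a uniform size. -/
theorem IsMinimal.exists_hasUniformDomains [CompactSpace Z] [Nonempty X] (hL : L.IsMinimal)
    (hh : L.IsChart h) (hΓ : L.IsHolonomyPseudoStarGroup h Γ)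
    (heq : ∀ ε > 0, ∃ δ > 0, ∀ γ ∈ Γ, ∀ x ∈ γ.source, ∀ x' ∈ γ.source,
      dist x x' < δ → dist (γ x) (γ x') ≤ ε) {V : Set X} (hV : IsOpen V)
    (hVc : IsCompact (closure V)) : ∃ δ > 0, HasUniformDomains Γ V δ := by
  choose N₁ π₁ hN hzN hπ₁ using hL.exists_isTransverseProjection hh
  have hnhds : ∀ z, ∃ C, IsCompact C ∧ C ∈ 𝓝 z ∧ C ⊆ N₁ z := fun z => by
    obtain ⟨C, hC, hCN, hCc⟩ := local_compact_nhds ((hN z).mem_nhds (hzN z))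
    exact ⟨C, hCc, hC, hCN⟩
  choose C₁ hC₁ hCz hCN₁ using hnhds
  obtain ⟨t, -, ht⟩ := isCompact_univ.elim_nhds_subcover (fun z => interior (C₁ z))
    fun z _ => interior_mem_nhds.mpr (hCz z)
  -- the index `none` stands for the chart `h` itself
  obtain ⟨N, hNn, hNs⟩ : ∃ N : Option t → Set Z, N none = range h ∧ ∀ z, N (some z) = N₁ z :=
    ⟨fun a => a.elim (range h) fun z => N₁ z, rfl, fun _ => rfl⟩
  obtain ⟨π, hπn, hπs⟩ : ∃ π : Option t → Z → X, (π none = fun z => (chartInv h z).2) ∧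
      ∀ z, π (some z) = π₁ z :=
    ⟨fun a => a.elim (fun z => (chartInv h z).2) fun z => π₁ z, rfl, fun _ => rfl⟩
  obtain ⟨C, hCn, hCs⟩ : ∃ C : Option t → Set Z,
      C none = (fun x => h (0, x)) '' closure V ∧ ∀ z, C (some z) = C₁ z :=
    ⟨fun a => a.elim ((fun x => h (0, x)) '' closure V) fun z => C₁ z, rfl, fun _ => rfl⟩
  have hπ : ∀ a, L.IsTransverseProjection h (N a) (π a) := by
    rintro (_ | z)
    · rw [hNn, hπn]; exact isTransverseProjection_chart hh
    · rw [hNs, hπs]; exact hπ₁ z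
  have hCN : ∀ a, C a ⊆ N a := by
    rintro (_ | z)
    · rw [hCn, hNn]
      rintro _ ⟨x, -, rfl⟩
      exact mem_range_self _
    · rw [hCs, hNs]; exact hCN₁ z
  have hC : ∀ a, IsCompact (C a) := by
    rintro (_ | z)
    · rw [hCn]
      exact hVc.image (hh.isOpenEmbedding.continuous.comp (by fun_prop))
    · rw [hCs]; exact hC₁ z
  have hπh : ∀ x, π none (h (0, x)) = x := fun x => by
    simp only [hπn, chartInv_apply hh.isOpenEmbedding]
  have hrad : ∀ᶠ r in 𝓝[>] (0 : ℝ), ∀ a b, ∀ z ∈ C a ∩ C b, ∃ γ ∈ Γ,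
      Metric.ball (π a z) r ⊆ γ.source ∧ γ (π a z) = π b z := by
    rw [eventually_all]
    intro a
    rw [eventually_all]
    intro b
    exact eventually_exists_ball_subset_source hΓ (hπ a) (hπ b) ((hC a).inter (hC b))
      (inter_subset_left.trans (hCN a)) (inter_subset_right.trans (hCN b))
  obtain ⟨r, hr, hr0⟩ := (hrad.and self_mem_nhdsWithin).exists
  have hr0 : 0 < r := hr0
  -- Every map of `Γ` sends a ball of radius `δ₀` in its domain into a ball of radius `r`, which is
  -- where the next transition is defined.
  obtain ⟨δ₀, hδ₀, heqδ⟩ := heq (r / 2) (by positivity)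
  obtain ⟨δ, hδ, hδδ₀, hδr⟩ : ∃ δ > 0, δ ≤ δ₀ ∧ δ ≤ r :=
    ⟨min δ₀ r, lt_min hδ₀ hr0, min_le_left _ _, min_le_right _ _⟩
  have hG := hΓ.isPseudoStarGroup
  have chain : ∀ (c : I → Z), L.IsLeafwise c → ∀ y ∈ closure V, ∀ x ∈ closure V,
      c 0 = h (0, y) → c 1 = h (0, x) → ∃ γ ∈ Γ, γ.source = Metric.ball y δ ∧ γ y = x := by
    intro c hc y hy x hx hc0 hc1
    set P : I → Prop := fun τ => ∀ a, c τ ∈ C a →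
      ∃ γ ∈ Γ, γ.source = Metric.ball y δ ∧ γ y = π a (c τ) with hP
    have hloc : IsLocallyConstant P := by
      rw [IsLocallyConstant.iff_eventually_eq]
      intro τ
      obtain ⟨z, hzt, hz⟩ := mem_iUnion₂.mp (ht (mem_univ (c τ)))
      obtain ⟨a, ha⟩ : ∃ a, C a ∈ 𝓝 (c τ) :=
        ⟨some ⟨z, hzt⟩, by rw [hCs]; exact mem_interior_iff_mem_nhds.mp hz⟩
      have hstep : ∀ τ₁ τ₂, c τ₁ ∈ C a → c τ₂ ∈ C a → π a (c τ₁) = π a (c τ₂) → P τ₁ → P τ₂ := by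
        intro τ₁ τ₂ h1 h2 h12 hP1 b hb
        obtain ⟨γ, hγ, hγs, hγy⟩ := hP1 a h1
        obtain ⟨γ', hγ', hγs', hγy'⟩ := hr a b (c τ₂) ⟨h2, hb⟩
        -- The composite so far belongs to `Γ`, so its modulus of continuity has not deteriorated
        -- and composing does not shrink the domain.
        refine ⟨γ.trans γ', hG.trans_mem' hγ hγ', ?_, ?_⟩
        · rw [OpenPartialHomeomorph.trans_source, ← hγs]
          refine inter_eq_self_of_subset_left fun x' hx' => hγs' ?_
          have h3 := heqδ γ hγ x' hx' y (hγs ▸ Metric.mem_ball_self hδ)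
            (lt_of_lt_of_le (Metric.mem_ball.mp (hγs ▸ hx')) hδδ₀)
          rw [hγy, h12] at h3
          rw [Metric.mem_ball]
          linarith
        · rw [OpenPartialHomeomorph.coe_trans, Function.comp_apply, hγy, h12, hγy']
      have haτ := mem_of_mem_nhds ha
      filter_upwards [(hπ a).eventually_eq hc (hCN a haτ), hc.1.continuousAt.eventually ha]
        with τ' h1 h2
      exact propext ⟨hstep _ _ h2 haτ h1, hstep _ _ haτ h2 h1.symm⟩
    have hP0 : P 0 := fun b hb => by
      have h0 : c 0 ∈ C none := by
        rw [hCn, hc0]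
        exact mem_image_of_mem _ hy
      obtain ⟨γ, hγ, hγs, hγy⟩ := hr none b (c 0) ⟨h0, hb⟩
      have hπ0 : π none (c 0) = y := by rw [hc0, hπh]
      rw [hπ0] at hγs hγy
      have hsub : Metric.ball y δ ⊆ γ.source := (Metric.ball_subset_ball hδr).trans hγs
      refine ⟨_, hG.restr_mem γ hγ _ Metric.isOpen_ball hsub, ?_, hγy⟩
      rw [OpenPartialHomeomorph.restrOpen_source, inter_eq_self_of_subset_right hsub]
    have hP1 : P 1 := (hloc.apply_eq_of_preconnectedSpace 0 1) ▸ hP0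
    have h1 : c 1 ∈ C none := by
      rw [hCn, hc1]
      exact mem_image_of_mem _ hx
    obtain ⟨γ, hγ, hγs, hγy⟩ := hP1 none h1
    exact ⟨γ, hγ, hγs, by rw [hγy, hc1, hπh]⟩
  refine ⟨δ, hδ, fun x hx y hy W hW hyW => ?_⟩
  -- Minimality leads from `x` to a point `γ₀ x` near `y`. The curve is then followed backwards,
  -- giving a map defined on the ball of radius `δ` about `γ₀ x`.
  obtain ⟨γ₀, hγ₀, hxs, hγx⟩ := hL.exists_isHolonomyMap hh x (hW.inter hV) ⟨y, hyW, hy⟩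
  obtain ⟨-, D, -, hxD, -, H, -, -, hH⟩ := hγ₀ x hxs
  obtain ⟨hl, h0, h1⟩ := hH x hxD
  obtain ⟨γ, hγ, hγs, hγy⟩ := chain _ hl.symm (γ₀ x) (subset_closure hγx.2) x (subset_closure hx)
    (by simpa using h1) (by simpa using h0)
  exact ⟨γ, hγ, γ₀ x, hγx.1, hγs.ge, hγs ▸ Metric.mem_ball_self hδ, hγy⟩

end UniformDomains

end Lamination

/-! ### The theorem for laminations -/

theorem theorem1 {p : ℕ} {Z : Type*} [MetricSpace Z] [LocallyCompactSpace Z]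
    (L : Lamination p Z) (hL : L.IsMinimal)
    {X : Type*} [TopologicalSpace X] [Nonempty X] [MeasurableSpace X] [BorelSpace X]
    (h : PlaqueModel p × X → Z) (hh : L.IsChart h) (heq : L.TransverselyEquicontinuous h) :
    (∃ μ : Measure X, μ.Regular ∧ μ ≠ 0 ∧ L.HolonomyInvariant h μ) ∧
    (CompactSpace Z →
      ∀ μ ν : Measure X, μ.Regular → ν.Regular → μ ≠ 0 →
        L.HolonomyInvariant h μ → L.HolonomyInvariant h ν → ∃ c : NNReal, ν = c • μ) := by
  have hemb : IsEmbedding fun x : X => h (0, x) :=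
    hh.isOpenEmbedding.isEmbedding.comp (isEmbedding_prodMkRight 0)
  -- This metric induces the given topology of `X`, and its distance is by definition that of the
  -- points `h (0, x)`, so the equicontinuity hypothesis applies verbatim.
  let : MetricSpace X := hemb.comapMetricSpace _
  have : LocallyCompactSpace (PlaqueModel p × X) := hh.isOpenEmbedding.locallyCompactSpace
  -- `X` is the closed slice over `0` in the product, which is locally compact as an open piece of
  -- `Z`.
  have : LocallyCompactSpace X :=
    (IsClosedEmbedding.mk (isEmbedding_prodMkRight (0 : PlaqueModel p)) (by
      have : range (Prod.mk (0 : PlaqueModel p) : X → _) = {0} ×ˢ univ := by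
        ext ⟨a, b⟩; simp [eq_comm]
      rw [this]
      exact isClosed_singleton.prod isClosed_univ)).locallyCompactSpace
  obtain ⟨Γ, hΓ, hΓe⟩ := heq
  replace hΓe : ∀ ε > 0, ∃ δ > 0, ∀ γ ∈ Γ, ∀ x ∈ γ.source, ∀ x' ∈ γ.source,
    dist x x' < δ → dist (γ x) (γ x') ≤ ε := hΓe
  have hG := hΓ.isPseudoStarGroup
  have hmin : ∀ (x : X) (U : Set X), IsOpen U → U.Nonempty → ∃ γ ∈ Γ, x ∈ γ.source ∧ γ x ∈ U := by
    intro x U hU hne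
    obtain ⟨γ₀, hγ₀, hx, hxU⟩ := hL.exists_isHolonomyMap hh x hU hne
    obtain ⟨γ, hγ, hxγ, -, he⟩ := hΓ.exists_restr γ₀ hγ₀ x hx
    exact ⟨γ, hγ, hxγ, by rwa [he hxγ]⟩
  refine ⟨?_, fun hZ μ ν hμ hν hμ0 hμi hνi => ?_⟩
  · obtain ⟨μ, hμ, hμ0, hμi⟩ := exists_regular_integralInvariant hG hΓe hmin
    exact ⟨μ, hμ, hμ0, fun γ hγ => integralInvariant_of_local hμi (hΓ.exists_restr γ hγ)⟩
  · have : SecondCountableTopology X := hemb.secondCountableTopology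
    exact exists_eq_smul_of_integralInvariant hG hΓe hmin
      (fun V hV hVc => hL.exists_hasUniformDomains hh hΓ hΓe hV hVc)
      (fun γ hγ => hμi γ (hΓ.isHolonomyMap γ hγ)) (fun γ hγ => hνi γ (hΓ.isHolonomyMap γ hγ)) hμ0
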